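/- Let $\mathbb D=\{z\in\mathbb C:|z|<1\}$, let $dA=\pi^{-1}\,dx\,dy$, and let $\mathcal S_b$ be the class of bounded injective holomorphic functions $\varphi:\mathbb D\to\mathbb C$ with $\varphi(0)=0$ and $\varphi'(0)=1$. **Theorem 1.1.** There are absolute constants $C>0$ and $\delta>0$ such that the following holds for every $\varphi\in\mathcal S_b$. The function $z\varphi'(z)/\varphi(z)$ (with its removable singularity at $0$ filled in) has a holomorphic logarithm on $\mathbb D$, and for every holomorphic branch $L$ of $\log\big(z\varphi'(z)/\varphi(z)\big)$ on $\mathbb D$ and every $\tau\in\mathbb C$ with $|\tau|<\delta$, $$\int_{\mathbb D}\left|\left(z\frac{\varphi'(z)}{\varphi(z)}\right)^{2-\tau}\right|\,(1-|z|^2)^{-\operatorname{Re}\tau+C|\tau|^2\log\frac1{|\tau|}}\,dA(z)<+\infty ,$$ where $\big(z\varphi'(z)/\varphi(z)\big)^{2-\tau}:=e^{(2-\tau)L(z)}$, and $|\tau|^2\log\frac1{|\tau|}$ is read as $0$ for $\tau=0$. -/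

import Mathlib

open MeasureTheory Metric Set

/-- The class `𝒮`: univalent (holomorphic and injective) functions on the open unit disc,
normalized by `φ(0) = 0` and `φ'(0) = 1`. -/
def classS : Set (ℂ → ℂ) :=
  {φ | DifferentiableOn ℂ φ (ball 0 1) ∧ InjOn φ (ball 0 1) ∧ φ 0 = 0 ∧ deriv φ 0 = 1}

/-- The class `𝒮_b`: the functions of class `𝒮` that are bounded on the open unit disc. -/
def classSb : Set (ℂ → ℂ) :=
  {φ | φ ∈ classS ∧ Bornology.IsBounded (φ '' ball 0 1)}

/-- `L` is a holomorphic branch on the open unit disc of `log (z φ'(z) / φ(z))`.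
The quotient has a removable singularity at `0`, so the identity is asked for `z ≠ 0` only;
it then fixes `L` up to an additive constant in `2πiℤ`. -/
def IsLogBranch (φ L : ℂ → ℂ) : Prop :=
  DifferentiableOn ℂ L (ball 0 1) ∧
    ∀ z ∈ ball (0 : ℂ) 1, z ≠ 0 → Complex.exp (L z) = z * deriv φ z / φ z

/-- The power `(z φ'(z) / φ(z)) ^ a` defined by the branch `L` of the logarithm. -/
noncomputable def branchPow (L : ℂ → ℂ) (a z : ℂ) : ℂ := Complex.exp (a * L z)

/-- The normalized area measure `dA = π⁻¹ dx dy` on the plane. -/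
noncomputable def areaMeasure : Measure ℂ := ENNReal.ofReal (Real.pi⁻¹) • volume

/-! Write Ω = φ(𝔻), w = φ(a), t = |τ|, N(a) = log(1/(1-|a|²)) and X(a) = L(a) - L(0) - N(a). Since
φ(z)/z is bounded away from 0, |e^{2L}| is at most a constant times |φ'|², the Jacobian of φ. After
the change of variables to Ω it remains to integrate |e^{-τL}| times the weight. The factor
(1-|z|²)^{-Re τ} cancels the Re τ · N part of τL, so everything reduces to showing that t|X| ≤ C t²
log(1/t) N + B + (a function of w with integrable exponential over Ω).

The quantity X has an exact formula: πX(a) is the integral of a/(1-a z̄) · φ'(z)/(φ(z)-w) over the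
points with |φ(z)-w| ≥ ρ, where ρ = dist(w, Ωᶜ)/2. It comes from the Bergman reproducing property
applied to a logarithm of the difference quotient of φ (`integral_bergman_logDeriv`,
`IsLogBranch.exists_log_dslope`).

A quadratic inequality separates the integrand into a kernel term, whose integral is O(N + 1)
(`lintegral_kernelWeight_le`), and |φ'|²/|φ-w|², which φ carries to the logarithmic energy ∫ |y-w|⁻²
dy over part of Ω. The energy is split according to whether dist(y, Ωᶜ) exceeds ε|y-w|, with ε = t³.
On the thin part a Koebe estimate gives |φ'|(1-|z|) ≤ 32ε|φ-w|; this improves the inequality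
(`le_quadratic_of_le_div`), and the crude energy bound of an annulus, O(N + 1), then enters with
coefficient t² only.

On the thick part the energy is exponentially integrable with exponent of order 1/log(1/ε)
(`exists_lintegral_exp_thickEnergy_le`): it is a sum over scales 4^k of averaged densities of layers
of Ω, and each point lies in O(log(1/ε)) layers. Balancing the two terms of the quadratic inequality
against this exponent produces t² log(1/t) (`exists_norm_log_le`). -/

/-! ### Injective holomorphic functions: inverses and logarithms. -/

open Filter Topology in
theorem image_mem_nhds_of_injOn {f : ℂ → ℂ} {U V : Set ℂ} (hU : IsOpen U)
    (hf : DifferentiableOn ℂ f U) (hi : InjOn f U) {z : ℂ} (hz : z ∈ U) (hV : V ∈ 𝓝 z) :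
    f '' V ∈ 𝓝 (f z) := by
  have han : AnalyticAt ℂ f z := hf.analyticAt (hU.mem_nhds hz)
  rcases han.eventually_constant_or_nhds_le_map_nhds with h | h
  · exfalso
    have h1 : ∀ᶠ w in 𝓝 z, w = z := by
      filter_upwards [h, hU.mem_nhds hz] with w hw hwU using hi hwU hz hw
    have h2 : ∀ᶠ w in 𝓝[≠] z, False := by
      filter_upwards [h1.filter_mono nhdsWithin_le_nhds, self_mem_nhdsWithin] with w hw hw'
      exact hw' hw
    simp at h2
    exact (NeBot.ne (inferInstance : (𝓝[≠] z).NeBot)) h2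
  · exact h (image_mem_map hV)

theorem isOpen_image_of_injOn {f : ℂ → ℂ} {U V : Set ℂ} (hU : IsOpen U)
    (hf : DifferentiableOn ℂ f U) (hi : InjOn f U) (hV : IsOpen V) (hVU : V ⊆ U) :
    IsOpen (f '' V) := by
  rw [isOpen_iff_mem_nhds]
  rintro _ ⟨z, hz, rfl⟩
  exact image_mem_nhds_of_injOn hU hf hi (hVU hz) (hV.mem_nhds hz)

open Filter Topology Function in
theorem continuousAt_invFunOn {f : ℂ → ℂ} {U : Set ℂ} (hU : IsOpen U)
    (hf : DifferentiableOn ℂ f U) (hi : InjOn f U) {z : ℂ} (hz : z ∈ U) :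
    ContinuousAt (invFunOn f U) (f z) := by
  rw [ContinuousAt, hi.leftInvOn_invFunOn hz]
  intro V hV
  have := image_mem_nhds_of_injOn hU hf hi hz (inter_mem hV (hU.mem_nhds hz))
  rw [mem_map]
  filter_upwards [this]
  rintro _ ⟨v, hv, rfl⟩
  rw [mem_preimage, hi.leftInvOn_invFunOn hv.2]
  exact hv.1

open Filter Topology Function in
theorem hasDerivAt_invFunOn_of_ne_zero {f : ℂ → ℂ} {U : Set ℂ} (hU : IsOpen U)
    (hf : DifferentiableOn ℂ f U) (hi : InjOn f U) {z : ℂ} (hz : z ∈ U) (h0 : deriv f z ≠ 0) :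
    HasDerivAt (invFunOn f U) (deriv f z)⁻¹ (f z) := by
  apply HasDerivAt.of_local_left_inverse (f := f) (continuousAt_invFunOn hU hf hi hz) _ h0
  · filter_upwards [image_mem_nhds_of_injOn hU hf hi hz (hU.mem_nhds hz)]
    rintro _ ⟨v, hv, rfl⟩
    rw [hi.leftInvOn_invFunOn hv]
  · rw [hi.leftInvOn_invFunOn hz]
    exact (hf.differentiableAt (hU.mem_nhds hz)).hasDerivAt

open Filter Topology Function in
/-- An injective holomorphic function has no critical point. -/
theorem deriv_ne_zero_of_injOn {f : ℂ → ℂ} {U : Set ℂ} (hU : IsOpen U)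
    (hf : DifferentiableOn ℂ f U) (hi : InjOn f U) {z : ℂ} (hz : z ∈ U) : deriv f z ≠ 0 := by
  have hUz := hU.mem_nhds hz
  have hd : AnalyticAt ℂ (deriv f) z := (hf.analyticAt hUz).deriv
  have hev : ∀ᶠ w in 𝓝[≠] z, deriv f w ≠ 0 := by
    rcases hd.eventually_eq_zero_or_eventually_ne_zero with h | h
    · exfalso
      obtain ⟨r, hr, hball⟩ := Metric.eventually_nhds_iff_ball.1 (h.and hUz)
      have hr' : (r / 2 : ℝ) < r := by linarith
      have hmem : z + (r / 2 : ℝ) ∈ ball z r := by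
        rw [mem_ball, dist_eq_norm, add_sub_cancel_left, Complex.norm_real, Real.norm_eq_abs,
          abs_of_pos (by linarith)]
        exact hr'
      have hc := isOpen_ball.is_const_of_deriv_eq_zero (convex_ball z r).isPreconnected
        (fun w hw => (hf w (hball w hw).2).mono (fun v hv => (hball v hv).2))
        (fun w hw => (hball w hw).1) hmem (mem_ball_self hr)
      have := hi (hball _ hmem).2 hz hc
      simp at this
      linarith
    · exact h
  -- The inverse is continuous at `f z` and, zeros of `deriv f` being isolated, holomorphic at
  -- nearby points other than `f z`. The singularity is removable, and the chain rule for `g ∘ f =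
  -- id` forbids a zero derivative.
  set g := invFunOn f U with hg
  have hgc : ContinuousAt g (f z) := continuousAt_invFunOn hU hf hi hz
  have hgz : g (f z) = z := hi.leftInvOn_invFunOn hz
  have hga : AnalyticAt ℂ g (f z) := by
    apply Complex.analyticAt_of_differentiable_on_punctured_nhds_of_continuousAt _ hgc
    have hev' : ∀ᶠ w in 𝓝 z, w ≠ z → deriv f w ≠ 0 := eventually_nhdsWithin_iff.1 hev
    rw [ContinuousAt, hgz] at hgc
    rw [eventually_nhdsWithin_iff]
    filter_upwards [hgc.eventually hev', image_mem_nhds_of_injOn hU hf hi hz hUz]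
    rintro _ hw ⟨v, hv, rfl⟩ hne
    rw [hg, hi.leftInvOn_invFunOn hv] at hw
    refine (hasDerivAt_invFunOn_of_ne_zero hU hf hi hv (hw ?_)).differentiableAt
    rintro rfl
    exact hne rfl
  have h1 : HasDerivAt (fun w => g (f w)) (deriv g (f z) * deriv f z) z :=
    hga.differentiableAt.hasDerivAt.comp z (hf.differentiableAt hUz).hasDerivAt
  have h2 : HasDerivAt (fun w => g (f w)) 1 z := by
    apply (hasDerivAt_id z).congr_of_eventuallyEq
    filter_upwards [hUz] with w hw
    exact hi.leftInvOn_invFunOn hw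
  intro h0
  have := h1.unique h2
  simp [h0] at this

theorem hasDerivAt_invFunOn {f : ℂ → ℂ} {U : Set ℂ} (hU : IsOpen U)
    (hf : DifferentiableOn ℂ f U) (hi : InjOn f U) {z : ℂ} (hz : z ∈ U) :
    HasDerivAt (Function.invFunOn f U) (deriv f z)⁻¹ (f z) :=
  hasDerivAt_invFunOn_of_ne_zero hU hf hi hz (deriv_ne_zero_of_injOn hU hf hi hz)

/-- A nonvanishing holomorphic function on a disc has a holomorphic logarithm. -/
theorem exists_differentiableOn_log {q : ℂ → ℂ} {c : ℂ} {r : ℝ} (hr : 0 < r)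
    (hq : DifferentiableOn ℂ q (ball c r)) (h0 : ∀ z ∈ ball c r, q z ≠ 0) {y : ℂ}
    (hy : Complex.exp y = q c) :
    ∃ l : ℂ → ℂ, DifferentiableOn ℂ l (ball c r) ∧ l c = y ∧
      ∀ z ∈ ball c r, Complex.exp (l z) = q z := by
  have hd : DifferentiableOn ℂ (fun z => deriv q z / q z) (ball c r) :=
    (hq.deriv isOpen_ball).div hq h0
  obtain ⟨l, hlc, hl⟩ := hd.isExactOn_ball.with_val_at c y
  refine ⟨l, fun z hz => (hl z hz).differentiableAt.differentiableWithinAt, hlc, fun z hz => ?_⟩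
  have hder : ∀ z ∈ ball c r, HasDerivAt (fun z => Complex.exp (-l z) * q z) 0 z := by
    intro z hz
    have h1 := ((hl z hz).neg.cexp).mul
      (hq.differentiableAt (isOpen_ball.mem_nhds hz)).hasDerivAt
    convert! h1 using 1
    have := h0 z hz
    field_simp
    ring
  have hc := isOpen_ball.is_const_of_deriv_eq_zero (convex_ball c r).isPreconnected
    (fun z hz => (hder z hz).differentiableAt.differentiableWithinAt)
    (fun z hz => (hder z hz).deriv) hz (mem_ball_self hr)
  simp only [hlc, ← hy, ← Complex.exp_add, neg_add_cancel, Complex.exp_zero] at hc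
  rw [Complex.exp_neg] at hc
  field_simp at hc
  exact hc.symm

/-! ### A covering theorem of Koebe type, by the square root transform. -/

/-- By the Schwarz lemma f(z)/z stays within 1/2 of 1 on a small circle, and the open mapping
estimate applies there. The radius depends on `M`; it serves only to make the infimum in
`koebe_of_bounded` positive. -/
theorem ball_subset_image_of_bounded {f : ℂ → ℂ} {M : ℝ} (hM : 1 ≤ M)
    (hf : DifferentiableOn ℂ f (ball 0 1)) (h0 : f 0 = 0) (h1 : deriv f 0 = 1)
    (hb : ∀ z ∈ ball (0 : ℂ) 1, ‖f z‖ ≤ M) :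
    ball 0 (1 / (8 * (1 + M))) ⊆ f '' ball 0 1 := by
  have hmaps : MapsTo f (ball 0 1) (closedBall (f 0) M) := fun z hz => by
    simpa [h0] using hb z hz
  have hg : DifferentiableOn ℂ (dslope f 0) (ball 0 1) :=
    (Complex.differentiableOn_dslope (ball_mem_nhds _ one_pos)).2 hf
  have hg0 : dslope f 0 0 = 1 := by simp [h1]
  have hgb : ∀ z ∈ ball (0 : ℂ) 1, ‖dslope f 0 z‖ ≤ M := fun z hz => by
    simpa using Complex.norm_dslope_le_div_of_mapsTo_ball hf hmaps hz
  set r : ℝ := 1 / (2 * (1 + M)) with hr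
  have hr0 : 0 < r := by positivity
  have hr1 : r < 1 := by rw [hr, div_lt_one (by positivity)]; linarith
  have hlow : ∀ z ∈ sphere (0 : ℂ) r, r / 2 ≤ ‖f z - f 0‖ := by
    intro z hz
    rw [mem_sphere_zero_iff_norm] at hz
    have hzb : z ∈ ball (0 : ℂ) 1 := by rw [mem_ball_zero_iff, hz]; exact hr1
    have hm : MapsTo (dslope f 0) (ball 0 1) (closedBall (dslope f 0 0) (1 + M)) := by
      intro w hw
      rw [mem_closedBall, dist_eq_norm, hg0]
      calc _ ≤ ‖dslope f 0 w‖ + ‖(1 : ℂ)‖ := norm_sub_le _ _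
        _ ≤ _ := by rw [norm_one]; linarith [hgb w hw]
    have h2 := Complex.dist_le_div_mul_dist_of_mapsTo_ball hg hm hzb
    rw [hg0, dist_eq_norm, dist_zero_right, hz, div_one, hr] at h2
    have h3 : (1 + M) * (1 / (2 * (1 + M))) = 1 / 2 := by field_simp
    rw [h3] at h2
    have h4 : 1 / 2 ≤ ‖dslope f 0 z‖ := by
      have := norm_sub_norm_le (1 : ℂ) (dslope f 0 z)
      rw [norm_sub_rev, norm_one] at this
      linarith
    have h5 : f z - f 0 = z * dslope f 0 z := by
      have := sub_smul_dslope f 0 z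
      simpa using this.symm
    rw [h5, norm_mul, hz]
    nlinarith
  have hsub : closedBall (0 : ℂ) r ⊆ ball 0 1 := closedBall_subset_ball hr1
  have hdc : DiffContOnCl ℂ f (ball 0 r) := by
    refine (hf.mono ?_).diffContOnCl
    rwa [closure_ball _ hr0.ne']
  have hfr : ∃ᶠ z in nhds (0 : ℂ), f z ≠ f 0 := by
    intro hcon
    have : f =ᶠ[nhds 0] fun _ => f 0 := by
      filter_upwards [hcon] with z hz
      simpa using hz
    have := this.deriv_eq
    simp [h1] at this
  have := hdc.ball_subset_image_closedBall hr0 hlow hfr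
  rw [h0] at this
  refine Subset.trans (fun x hx => ?_) (this.trans (image_mono hsub))
  convert hx using 2
  rw [hr]; field_simp; ring

/-- One step of the square root transform: if every univalent function bounded by `M` covers the
disc of radius `κ`, then every value omitted by such a function satisfies a quadratic bound. -/
theorem omitted_value_sq_bound {f : ℂ → ℂ} {M κ : ℝ} {a : ℂ} (hM : 8 ≤ M) (hκ : 0 < κ)
    (hcov : ∀ F : ℂ → ℂ, F ∈ classS → (∀ z ∈ ball (0 : ℂ) 1, ‖F z‖ ≤ M) →
      ball 0 κ ⊆ F '' ball 0 1)
    (hf : f ∈ classS) (hb : ∀ z ∈ ball (0 : ℂ) 1, ‖f z‖ ≤ M) (ha : a ∉ f '' ball 0 1)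
    (ha1 : ‖a‖ < 1 / 32) : κ / 32 ≤ ‖a‖ ^ 2 := by
  obtain ⟨hd, hi, h0, h1⟩ := hf
  have hz0 : (0 : ℂ) ∈ ball (0 : ℂ) 1 := mem_ball_self one_pos
  have ha0 : a ≠ 0 := by
    rintro rfl
    exact ha ⟨0, hz0, h0⟩
  have hna : 0 < ‖a‖ := norm_pos_iff.2 ha0
  have hq : DifferentiableOn ℂ (fun z => 1 - f z / a) (ball 0 1) := (hd.div_const a).const_sub 1
  have hq0 : ∀ z ∈ ball (0 : ℂ) 1, 1 - f z / a ≠ 0 := by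
    intro z hz h
    rw [sub_eq_zero, eq_comm, div_eq_one_iff_eq ha0] at h
    exact ha ⟨z, hz, h⟩
  obtain ⟨l, hl, hl0, hle⟩ := exists_differentiableOn_log one_pos hq hq0 (y := 0) (by simp [h0])
  -- ψ is a square root of 1 - f/a, and 2a(1 - ψ) is again normalized and univalent.
  set ψ : ℂ → ℂ := fun z => Complex.exp (l z / 2) with hψ
  have hψd : DifferentiableOn ℂ ψ (ball 0 1) := (hl.div_const 2).cexp
  have hψ0 : ψ 0 = 1 := by simp [hψ, hl0]
  have hψne : ∀ z, ψ z ≠ 0 := fun z => Complex.exp_ne_zero _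
  have hψsq : ∀ z ∈ ball (0 : ℂ) 1, ψ z ^ 2 = 1 - f z / a := by
    intro z hz
    rw [← hle z hz, hψ]
    simp only
    rw [← Complex.exp_nat_mul]
    congr 1
    push_cast
    ring
  have hψ' : HasDerivAt ψ (-(1 / (2 * a))) 0 := by
    have hψD := (hψd.differentiableAt (ball_mem_nhds 0 one_pos)).hasDerivAt
    have e1 : HasDerivAt (fun z => ψ z ^ 2) (2 * deriv ψ 0) 0 := by
      simpa [hψ0] using hψD.fun_pow 2
    have e2 : HasDerivAt (fun z => 1 - f z / a) (-(1 / a)) 0 := by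
      have := ((hd.differentiableAt (ball_mem_nhds 0 one_pos)).hasDerivAt.div_const a).const_sub 1
      rwa [h1] at this
    have e3 : HasDerivAt (fun z => ψ z ^ 2) (-(1 / a)) 0 := by
      apply e2.congr_of_eventuallyEq
      filter_upwards [ball_mem_nhds (0 : ℂ) one_pos] with z hz using hψsq z hz
    have e4 := e1.unique e3
    have e5 : deriv ψ 0 = -(1 / (2 * a)) := by
      field_simp at e4 ⊢
      linear_combination e4
    rwa [e5] at hψD
  have hψinj : ∀ z ∈ ball (0 : ℂ) 1, ∀ w ∈ ball (0 : ℂ) 1, ψ z ^ 2 = ψ w ^ 2 → z = w := by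
    intro z hz w hw h
    rw [hψsq z hz, hψsq w hw, sub_right_inj, div_left_inj' ha0] at h
    exact hi hz hw h
  have hFS : (fun z => 2 * a * (1 - ψ z)) ∈ classS := by
    refine ⟨(hψd.const_sub 1).const_mul _, ?_, by simp [hψ0], ?_⟩
    · intro z hz w hw h
      have h2 : (2 * a) ≠ 0 := by simpa using ha0
      have h3 : ψ z = ψ w := by
        have := mul_left_cancel₀ h2 h
        linear_combination -this
      exact hψinj z hz w hw (by rw [h3])
    · have := ((hψ'.const_sub 1).const_mul (2 * a)).deriv
      rw [this]
      field_simp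
  have hFb : ∀ z ∈ ball (0 : ℂ) 1, ‖2 * a * (1 - ψ z)‖ ≤ M := by
    intro z hz
    have e1 : ‖ψ z‖ ^ 2 ≤ 1 + M / ‖a‖ := by
      rw [← norm_pow, hψsq z hz]
      refine (norm_sub_le _ _).trans ?_
      rw [norm_one, norm_div]
      have := hb z hz
      gcongr
    have e2 : (‖a‖ * ‖ψ z‖) ^ 2 ≤ 1 + M := by
      rw [mul_pow]
      calc ‖a‖ ^ 2 * ‖ψ z‖ ^ 2 ≤ ‖a‖ ^ 2 * (1 + M / ‖a‖) := by gcongr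
        _ = ‖a‖ ^ 2 + ‖a‖ * M := by field_simp
        _ ≤ 1 + M := by nlinarith
    -- The transform preserves the bound `M` because 1 + M ≤ ((M-2)/2)², which holds once M ≥ 8.
    have e3 : ‖a‖ * ‖ψ z‖ ≤ (M - 2) / 2 := by
      apply le_of_sq_le_sq _ (by linarith)
      nlinarith
    calc ‖2 * a * (1 - ψ z)‖ = 2 * ‖a‖ * ‖1 - ψ z‖ := by simp
      _ ≤ 2 * ‖a‖ * (1 + ‖ψ z‖) := by
        gcongr
        simpa using norm_sub_le (1 : ℂ) (ψ z)
      _ ≤ M := by nlinarith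
  have hcovF := hcov _ hFS hFb
  -- ψ never takes both a value and its negative, since ψ² is injective and ψ has no zero. As 2a(1 -
  -- ψ) covers the disc of radius κ, the values of ψ near 1 are all taken, so those near -1 are
  -- omitted.
  have hfar : ∀ z ∈ ball (0 : ℂ) 1, κ / (2 * ‖a‖) ≤ ‖ψ z + 1‖ := by
    intro z hz
    by_contra! hcon
    have hu : 2 * a * (1 + ψ z) ∈ ball (0 : ℂ) κ := by
      rw [mem_ball_zero_iff, norm_mul, norm_mul, Complex.norm_ofNat, add_comm]
      rwa [lt_div_iff₀ (by positivity), mul_comm] at hcon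
    obtain ⟨w, hw, hw'⟩ := hcovF hu
    have h2 : (2 * a) ≠ 0 := by simpa using ha0
    have h3 : ψ w = - ψ z := by
      have := mul_left_cancel₀ h2 hw'
      linear_combination -this
    have h4 := hψinj w hw z hz (by rw [h3]; ring)
    rw [h4] at h3
    exact hψne z (by linear_combination h3 / 2)
  have hpos : 0 < κ / (2 * ‖a‖) := by positivity
  have hne : ∀ z ∈ ball (0 : ℂ) 1, ψ z + 1 ≠ 0 := fun z hz h => by
    have := hfar z hz
    rw [h, norm_zero] at this
    linarith
  have hHd : DifferentiableOn ℂ (fun z => (ψ z + 1)⁻¹) (ball 0 1) := (hψd.add_const 1).inv hne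
  have hHmaps : MapsTo (fun z => (ψ z + 1)⁻¹) (ball 0 1)
      (closedBall ((ψ 0 + 1)⁻¹) (2 * ‖a‖ / κ + 1 / 2)) := by
    intro z hz
    rw [mem_closedBall, dist_eq_norm]
    refine (norm_sub_le _ _).trans ?_
    rw [hψ0, norm_inv]
    refine add_le_add ?_ (by norm_num)
    rw [inv_le_comm₀ (norm_pos_iff.2 (hne z hz)) (by positivity), inv_div]
    exact hfar z hz
  -- The Schwarz bound for 1/(ψ + 1), whose derivative at 0 is 1/(8a), reads 1/(8|a|) ≤ 2|a|/κ +
  -- 1/2. For |a| < 1/32 the 1/2 is absorbed on the left.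
  have hder := Complex.norm_deriv_le_div_of_mapsTo_ball hHd hHmaps one_pos
  have hH' : deriv (fun z => (ψ z + 1)⁻¹) 0 = 1 / (8 * a) := by
    have := ((hψ'.add_const 1).inv (hne 0 hz0)).deriv
    simp only [hψ0] at this
    refine this.trans ?_
    field_simp
    norm_num
  rw [hH', div_one, norm_div, norm_mul, norm_one, Complex.norm_ofNat] at hder
  have h6 : 1 / (8 * ‖a‖) = 1 / 8 / ‖a‖ := by field_simp
  have h7 : 3 / 4 * (1 / 8 / ‖a‖) ≤ 2 * ‖a‖ / κ := by
    have : 1 / 2 ≤ 1 / 4 * (1 / 8 / ‖a‖) := by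
      rw [← mul_div_assoc, le_div_iff₀ hna]
      linarith
    rw [h6] at hder
    linarith
  rw [← mul_div_assoc, div_le_div_iff₀ hna hκ] at h7
  nlinarith

/-- Bootstrapping on the best covering radius κ for the bound `M`: an omitted value of modulus close
to κ would satisfy κ/32 ≤ |a|², which is impossible if κ < 1/32, because then κ² < κ/32. The result
no longer depends on `M`. -/
theorem koebe_of_bounded {f : ℂ → ℂ} {M : ℝ} (hf : f ∈ classS)
    (hb : ∀ z ∈ ball (0 : ℂ) 1, ‖f z‖ ≤ M) : ball 0 (1 / 32) ⊆ f '' ball 0 1 := by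
  wlog hM : 8 ≤ M generalizing M
  · exact this (M := 8) (fun z hz => (hb z hz).trans (by linarith)) le_rfl
  intro a₀ ha₀
  by_contra hcon
  rw [mem_ball_zero_iff] at ha₀
  set A : Set ℝ := {x | ∃ F : ℂ → ℂ, F ∈ classS ∧ (∀ z ∈ ball (0 : ℂ) 1, ‖F z‖ ≤ M) ∧
    ∃ a, a ∉ F '' ball 0 1 ∧ x = ‖a‖} with hA
  have hA0 : ‖a₀‖ ∈ A := ⟨f, hf, hb, a₀, hcon, rfl⟩
  set κ := sInf A with hκ
  have hlow : ∀ x ∈ A, 1 / (8 * (1 + M)) ≤ x := by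
    rintro x ⟨F, hF, hFb, a, ha, rfl⟩
    by_contra! h
    exact ha (ball_subset_image_of_bounded (by linarith) hF.1 hF.2.2.1 hF.2.2.2 hFb
      (by simpa using h))
  have hbdd : BddBelow A := ⟨_, hlow⟩
  have hκ0 : 0 < κ := lt_of_lt_of_le (by positivity) (le_csInf ⟨_, hA0⟩ hlow)
  have hκ1 : κ < 1 / 32 := (csInf_le hbdd hA0).trans_lt ha₀
  have hcov : ∀ F : ℂ → ℂ, F ∈ classS → (∀ z ∈ ball (0 : ℂ) 1, ‖F z‖ ≤ M) →
      ball 0 κ ⊆ F '' ball 0 1 := by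
    intro F hF hFb a ha
    by_contra h
    have := csInf_le hbdd (show ‖a‖ ∈ A from ⟨F, hF, hFb, a, h, rfl⟩)
    rw [mem_ball_zero_iff] at ha
    linarith
  have hlt : κ < √(κ / 32) := by
    apply Real.lt_sqrt_of_sq_lt
    nlinarith
  obtain ⟨x, ⟨F, hF, hFb, a, ha, rfl⟩, hx⟩ := exists_lt_of_csInf_lt ⟨_, hA0⟩ hlt
  have hs : √(κ / 32) < 1 / 32 := by
    rw [Real.sqrt_lt' (by norm_num)]
    linarith
  have := omitted_value_sq_bound hM hκ0 hcov hF hFb ha (hx.trans hs)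
  have h2 : ‖a‖ ^ 2 < κ / 32 := by
    rw [← Real.lt_sqrt (norm_nonneg a)]
    exact hx
  linarith

/-- A covering theorem of Koebe type for bounded univalent functions. -/
theorem koebe_ball_subset {f : ℂ → ℂ} {c : ℂ} {R M : ℝ} (hR : 0 < R)
    (hf : DifferentiableOn ℂ f (ball c R)) (hi : InjOn f (ball c R))
    (hb : ∀ z ∈ ball c R, ‖f z‖ ≤ M) :
    ball (f c) (R * ‖deriv f c‖ / 32) ⊆ f '' ball c R := by
  have hc : c ∈ ball c R := mem_ball_self hR
  have h0 : deriv f c ≠ 0 := deriv_ne_zero_of_injOn isOpen_ball hf hi hc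
  have hR' : (R : ℂ) ≠ 0 := by exact_mod_cast hR.ne'
  have hm : MapsTo (fun z : ℂ => c + R * z) (ball 0 1) (ball c R) := by
    intro z hz
    rw [mem_ball_zero_iff] at hz
    rw [mem_ball, dist_eq_norm, add_sub_cancel_left, norm_mul, Complex.norm_real,
      Real.norm_eq_abs, abs_of_pos hR]
    nlinarith
  have hinner : DifferentiableOn ℂ (fun z : ℂ => c + R * z) (ball 0 1) := by fun_prop
  set F : ℂ → ℂ := fun z => (f (c + R * z) - f c) / (R * deriv f c) with hF
  have hFS : F ∈ classS := by
    refine ⟨((hf.comp hinner hm).sub_const _).div_const _, ?_, by simp [hF], ?_⟩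
    · intro z hz w hw h
      rw [hF] at h
      simp only [div_left_inj' (mul_ne_zero hR' h0), sub_left_inj] at h
      have := hi (hm hz) (hm hw) h
      simpa [hR'] using this
    · have e1 : HasDerivAt (fun z : ℂ => c + R * z) R 0 := by
        simpa using ((hasDerivAt_id (0 : ℂ)).const_mul (R : ℂ)).const_add c
      have e2 : HasDerivAt f (deriv f c) (c + R * 0) := by
        simpa using (hf.differentiableAt (isOpen_ball.mem_nhds hc)).hasDerivAt
      have e3 := ((e2.comp 0 e1).sub_const (f c)).div_const (R * deriv f c)
      refine e3.deriv.trans ?_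
      field_simp
  have hFb : ∀ z ∈ ball (0 : ℂ) 1, ‖F z‖ ≤ (M + ‖f c‖) / ‖(R * deriv f c : ℂ)‖ := by
    intro z hz
    rw [hF]
    simp only [norm_div]
    gcongr
    exact (norm_sub_le _ _).trans (by linarith [hb _ (hm hz)])
  intro w hw
  have hd : (R * deriv f c : ℂ) ≠ 0 := mul_ne_zero hR' h0
  have hw' : (w - f c) / (R * deriv f c) ∈ ball (0 : ℂ) (1 / 32) := by
    rw [mem_ball, dist_eq_norm] at hw
    rw [mem_ball_zero_iff, norm_div, div_lt_iff₀ (norm_pos_iff.2 hd), norm_mul,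
      Complex.norm_real, Real.norm_eq_abs, abs_of_pos hR]
    linarith
  obtain ⟨z, hz, hz'⟩ := koebe_of_bounded hFS hFb hw'
  refine ⟨_, hm hz, ?_⟩
  rw [hF] at hz'
  simp only [div_left_inj' hd, sub_left_inj] at hz'
  exact hz'

/-! ### Exponential integrability of the thick logarithmic energy. -/

section Energy

open ENNReal

/-- The mass of the profile `exp (-2‖x‖/3)` on the plane. -/
noncomputable def expMass : ℝ≥0∞ := ∫⁻ x : ℂ, ENNReal.ofReal (Real.exp (-(2 / 3 * ‖x‖)))

theorem expMass_lt_top : expMass < ⊤ := by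
  have hfin : Integrable (fun x : ℂ => (9 / 2 : ℝ) ^ 3 * (1 + ‖x‖) ^ (-(3 : ℝ))) :=
    (integrable_one_add_norm (by simp [Complex.finrank_real_complex]; norm_num)).const_mul _
  refine lt_of_le_of_lt (lintegral_mono fun x => ENNReal.ofReal_le_ofReal ?_)
    hfin.lintegral_lt_top
  have hx := norm_nonneg x
  have h1 : 2 / 9 * (1 + ‖x‖) ≤ Real.exp (2 / 9 * ‖x‖) := by
    linarith [Real.add_one_le_exp (2 / 9 * ‖x‖)]
  have h2 : (2 / 9 * (1 + ‖x‖)) ^ 3 ≤ Real.exp (2 / 3 * ‖x‖) := by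
    calc _ ≤ Real.exp (2 / 9 * ‖x‖) ^ 3 := by gcongr
      _ = _ := by rw [← Real.exp_nat_mul]; congr 1; push_cast; ring
  rw [Real.exp_neg, Real.rpow_neg (by positivity)]
  norm_cast
  rw [← div_eq_mul_inv, inv_eq_one_div, div_le_div_iff₀ (Real.exp_pos _) (by positivity)]
  nlinarith

theorem expMass_pos : 0 < expMass := by
  rw [expMass, lintegral_pos_iff_support (by fun_prop)]
  have : Function.support (fun x : ℂ => ENNReal.ofReal (Real.exp (-(2 / 3 * ‖x‖)))) = univ := by
    ext x
    simp [Real.exp_pos]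
  rw [this]
  simp

theorem lintegral_exp_scaled {ρ : ℝ} (hρ : 0 < ρ) (y : ℂ) :
    ∫⁻ w : ℂ, ENNReal.ofReal (ρ ^ 2 * Real.exp (-(2 / 3 * (ρ * ‖w - y‖)))) = expMass := by
  have h1 : ∫⁻ w : ℂ, ENNReal.ofReal (ρ ^ 2 * Real.exp (-(2 / 3 * (ρ * ‖w - y‖)))) =
      ∫⁻ w : ℂ, ENNReal.ofReal (ρ ^ 2 * Real.exp (-(2 / 3 * (ρ * ‖w‖)))) :=
    lintegral_sub_right_eq_self (μ := (volume : Measure ℂ))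
      (fun w : ℂ => ENNReal.ofReal (ρ ^ 2 * Real.exp (-(2 / 3 * (ρ * ‖w‖))))) y
  rw [h1]
  have h2 := Measure.map_addHaar_smul (volume : Measure ℂ) hρ.ne'
  have h3 : ∫⁻ w : ℂ, ENNReal.ofReal (Real.exp (-(2 / 3 * ‖ρ • w‖))) =
      ∫⁻ x, ENNReal.ofReal (Real.exp (-(2 / 3 * ‖x‖))) ∂(Measure.map (ρ • ·) (volume : Measure ℂ)) := by
    rw [lintegral_map (by fun_prop) (by fun_prop)]
  rw [h2, lintegral_smul_measure, Complex.finrank_real_complex] at h3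
  simp_rw [ENNReal.ofReal_mul (sq_nonneg ρ)]
  rw [lintegral_const_mul _ (by fun_prop)]
  simp only [norm_smul, Real.norm_eq_abs, abs_of_pos hρ] at h3
  rw [h3, smul_eq_mul, ← mul_assoc, ← ENNReal.ofReal_mul (sq_nonneg ρ),
    abs_of_pos (by positivity), mul_inv_cancel₀ (by positivity), ENNReal.ofReal_one, one_mul]
  rfl

/-- The exponentially weighted density of the set `S` around `w` at scale `1 / ρ`. -/
noncomputable def expDensity (S : Set ℂ) (ρ : ℝ) (w : ℂ) : ℝ≥0∞ :=
  ∫⁻ y in S, ENNReal.ofReal (ρ ^ 2 * Real.exp (-(ρ * ‖w - y‖)))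

theorem measurable_expDensity (S : Set ℂ) (ρ : ℝ) : Measurable (expDensity S ρ) := by
  apply Measurable.lintegral_prod_right'
    (f := fun p : ℂ × ℂ => ENNReal.ofReal (ρ ^ 2 * Real.exp (-(ρ * ‖p.1 - p.2‖))))
  fun_prop

theorem expDensity_le {S : Set ℂ} {ρ : ℝ} (hρ : 0 < ρ) (w : ℂ) :
    expDensity S ρ w ≤ expMass := by
  rw [← lintegral_exp_scaled hρ w]
  refine (setLIntegral_le_lintegral _ _).trans (lintegral_mono fun y => ?_)
  apply ENNReal.ofReal_le_ofReal
  rw [norm_sub_rev]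
  have : 0 ≤ ρ * ‖y - w‖ := by positivity
  exact mul_le_mul_of_nonneg_left (Real.exp_le_exp.2 (by linarith)) (sq_nonneg ρ)

theorem expDensity_le_exp_mul {S : Set ℂ} {ρ : ℝ} (hρ : 0 < ρ) (w y : ℂ) :
    expDensity S ρ w ≤ ENNReal.ofReal (Real.exp (ρ * ‖w - y‖)) * expDensity S ρ y := by
  rw [expDensity, expDensity, ← lintegral_const_mul _ (by fun_prop)]
  refine lintegral_mono fun x => ?_
  rw [← ENNReal.ofReal_mul (Real.exp_pos _).le]
  apply ENNReal.ofReal_le_ofReal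
  rw [mul_left_comm, ← Real.exp_add]
  gcongr
  have : ‖y - x‖ ≤ ‖w - y‖ + ‖w - x‖ := by
    rw [norm_sub_rev w y]
    exact norm_sub_le_norm_sub_add_norm_sub y w x
  nlinarith

/-- The product of `1 + c f_j` over the first `n` scales `4 ^ j * ρ`. -/
noncomputable def densityProd (S : ℕ → Set ℂ) (ρ : ℝ) (c : ℝ≥0∞) (n : ℕ) (w : ℂ) : ℝ≥0∞ :=
  ∏ j ∈ Finset.range n, (1 + c * expDensity (S j) (4 ^ j * ρ) w)

theorem measurable_densityProd (S : ℕ → Set ℂ) (ρ : ℝ) (c : ℝ≥0∞) (n : ℕ) :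
    Measurable (densityProd S ρ c n) :=
  Finset.measurable_fun_prod _ fun j _ =>
    ((measurable_expDensity (S j) (4 ^ j * ρ)).const_mul c).const_add 1

theorem densityProd_mono (S : ℕ → Set ℂ) (ρ : ℝ) (c : ℝ≥0∞) (w : ℂ) :
    Monotone fun n => densityProd S ρ c n w := by
  refine monotone_nat_of_le_succ fun n => ?_
  simp only [densityProd, Finset.prod_range_succ]
  exact le_mul_of_one_le_right' le_self_add

/-- A Harnack inequality: the factor at scale j changes by at most exp(4^j ρ|w-y|), and the sum of
4^j over j < n is at most 4^n/3. The exponent 1/3 is less than 1, so the kernel of the next scale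
absorbs it and leaves the 2/3 in `expMass`. -/
theorem densityProd_le_exp_mul {S : ℕ → Set ℂ} {ρ : ℝ} (hρ : 0 < ρ) (c : ℝ≥0∞) (n : ℕ)
    (w y : ℂ) : densityProd S ρ c n w ≤
      ENNReal.ofReal (Real.exp (1 / 3 * (4 ^ n * ρ * ‖w - y‖))) * densityProd S ρ c n y := by
  induction n with
  | zero =>
    simp only [densityProd, Finset.range_zero, Finset.prod_empty, mul_one]
    rw [ENNReal.one_le_ofReal, Real.one_le_exp_iff]
    positivity
  | succ n ih =>
    have h4 : (0 : ℝ) < 4 ^ n * ρ := by positivity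
    have h1 : 1 + c * expDensity (S n) (4 ^ n * ρ) w ≤
        ENNReal.ofReal (Real.exp (4 ^ n * ρ * ‖w - y‖)) *
          (1 + c * expDensity (S n) (4 ^ n * ρ) y) := by
      rw [mul_add, mul_one]
      refine add_le_add ?_ ?_
      · rw [ENNReal.one_le_ofReal, Real.one_le_exp_iff]
        positivity
      · rw [mul_left_comm]
        gcongr
        exact expDensity_le_exp_mul h4 w y
    have h2 : Real.exp (1 / 3 * (4 ^ (n + 1) * ρ * ‖w - y‖)) =
        Real.exp (1 / 3 * (4 ^ n * ρ * ‖w - y‖)) * Real.exp (4 ^ n * ρ * ‖w - y‖) := by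
      rw [← Real.exp_add]; congr 1; ring
    rw [densityProd, densityProd, Finset.prod_range_succ, Finset.prod_range_succ, h2,
      ENNReal.ofReal_mul (Real.exp_pos _).le, mul_mul_mul_comm]
    exact mul_le_mul' ih h1

/-- Tonelli, then the Harnack inequality to replace the product at `w` by the product at `y`. The
product over coarser scales is nearly constant at the scale of the new density. -/
theorem lintegral_expDensity_mul_densityProd_le {S : ℕ → Set ℂ} {ρ : ℝ} (hρ : 0 < ρ)
    (c : ℝ≥0∞) (k : ℕ) (Ω : Set ℂ) :
    ∫⁻ w in Ω, expDensity (S k) (4 ^ k * ρ) w * densityProd S ρ c k w ≤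
      expMass * ∫⁻ y in S k, densityProd S ρ c k y := by
  have h4 : (0 : ℝ) < 4 ^ k * ρ := by positivity
  set r := 4 ^ k * ρ with hr
  have hmeas : Measurable fun p : ℂ × ℂ =>
      ENNReal.ofReal (r ^ 2 * Real.exp (-(r * ‖p.1 - p.2‖))) * densityProd S ρ c k p.1 :=
    Measurable.mul (by fun_prop) ((measurable_densityProd S ρ c k).comp measurable_fst)
  calc ∫⁻ w in Ω, expDensity (S k) r w * densityProd S ρ c k w
      = ∫⁻ w in Ω, ∫⁻ y in S k,
          ENNReal.ofReal (r ^ 2 * Real.exp (-(r * ‖w - y‖))) * densityProd S ρ c k w := by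
        congr with w
        rw [lintegral_mul_const _ (by fun_prop)]
        rfl
    _ = ∫⁻ y in S k, ∫⁻ w in Ω,
          ENNReal.ofReal (r ^ 2 * Real.exp (-(r * ‖w - y‖))) * densityProd S ρ c k w :=
        lintegral_lintegral_swap hmeas.aemeasurable
    _ ≤ ∫⁻ y in S k, expMass * densityProd S ρ c k y := by
        refine lintegral_mono fun y => ?_
        rw [← lintegral_exp_scaled h4 y, ← lintegral_mul_const _ (by fun_prop)]
        refine (setLIntegral_le_lintegral _ _).trans (lintegral_mono fun w => ?_)
        calc _ ≤ ENNReal.ofReal (r ^ 2 * Real.exp (-(r * ‖w - y‖))) *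
              (ENNReal.ofReal (Real.exp (1 / 3 * (r * ‖w - y‖))) * densityProd S ρ c k y) := by
              gcongr
              exact densityProd_le_exp_mul hρ c k w y
          _ = _ := by
              rw [← mul_assoc, ← ENNReal.ofReal_mul (by positivity), mul_assoc (r ^ 2),
                ← Real.exp_add]
              congr 4
              ring
    _ = expMass * ∫⁻ y in S k, densityProd S ρ c k y :=
        lintegral_const_mul _ (measurable_densityProd S ρ c k)

/-- Writing P for the products, P_{m+1} - P_m = c f_m P_m. Telescoping, moving each f_m onto its
layer, and using that layers overlap at most Λ times bounds the integral J of P_n by |Ω| +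
cΛ·`expMass`·J ≤ |Ω| + J/2. -/
theorem lintegral_densityProd_le {S : ℕ → Set ℂ} {ρ : ℝ} (hρ : 0 < ρ) {c Λ : ℝ≥0∞} {Ω : Set ℂ}
    (hc : c ≠ ⊤) (hΩ : volume Ω ≠ ⊤) (hSm : ∀ k, MeasurableSet (S k)) (hS : ∀ k, S k ⊆ Ω) {n : ℕ}
    (hΛ : ∀ y, ∑ k ∈ Finset.range n, (S k).indicator (1 : ℂ → ℝ≥0∞) y ≤ Λ)
    (hcΛ : c * expMass * Λ ≤ 2⁻¹) :
    ∫⁻ w in Ω, densityProd S ρ c n w ≤ 2 * volume Ω := by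
  have hstep : ∀ m, ∫⁻ w in Ω, densityProd S ρ c m w ≤
      volume Ω + ∑ k ∈ Finset.range m, c * expMass * ∫⁻ y in S k, densityProd S ρ c k y := by
    intro m
    induction m with
    | zero => simp [densityProd]
    | succ m ih =>
      rw [Finset.sum_range_succ, ← add_assoc]
      calc ∫⁻ w in Ω, densityProd S ρ c (m + 1) w
          = ∫⁻ w in Ω, (densityProd S ρ c m w +
              c * (expDensity (S m) (4 ^ m * ρ) w * densityProd S ρ c m w)) := by
            congr with w
            rw [densityProd, Finset.prod_range_succ, densityProd]
            ring
        _ = (∫⁻ w in Ω, densityProd S ρ c m w) +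
              c * ∫⁻ w in Ω, expDensity (S m) (4 ^ m * ρ) w * densityProd S ρ c m w := by
            rw [lintegral_add_left (measurable_densityProd S ρ c m), lintegral_const_mul]
            exact (measurable_expDensity _ _).mul (measurable_densityProd S ρ c m)
        _ ≤ _ := by
            rw [mul_assoc]
            exact add_le_add ih
              (mul_le_mul_right (lintegral_expDensity_mul_densityProd_le hρ c m Ω) c)
  have hsum : ∑ k ∈ Finset.range n, ∫⁻ y in S k, densityProd S ρ c k y ≤
      Λ * ∫⁻ y in Ω, densityProd S ρ c n y := by
    calc ∑ k ∈ Finset.range n, ∫⁻ y in S k, densityProd S ρ c k y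
        ≤ ∑ k ∈ Finset.range n, ∫⁻ y in Ω, (S k).indicator 1 y * densityProd S ρ c n y := by
          refine Finset.sum_le_sum fun k hk => ?_
          rw [← Set.inter_eq_left.2 (hS k), ← Measure.restrict_restrict (hSm k),
            ← lintegral_indicator (hSm k), Set.inter_eq_left.2 (hS k)]
          refine lintegral_mono fun y => ?_
          by_cases hy : y ∈ S k
          · simpa [hy] using densityProd_mono S ρ c y (Finset.mem_range.1 hk).le
          · simp [hy]
      _ = ∫⁻ y in Ω, (∑ k ∈ Finset.range n, (S k).indicator 1 y) * densityProd S ρ c n y := by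
          simp_rw [Finset.sum_mul]
          rw [lintegral_finsetSum]
          exact fun k _ =>
            (measurable_one.indicator (hSm k)).mul (measurable_densityProd S ρ c n)
      _ ≤ ∫⁻ y in Ω, Λ * densityProd S ρ c n y := by
          refine lintegral_mono fun y => ?_
          gcongr
          exact hΛ y
      _ = _ := lintegral_const_mul _ (measurable_densityProd S ρ c n)
  -- A crude bound depending on `n`, needed only so that half of the integral may be subtracted.
  have hfin : ∫⁻ w in Ω, densityProd S ρ c n w ≠ ⊤ := by
    have hb : ∀ w, densityProd S ρ c n w ≤ (1 + c * expMass) ^ n := by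
      intro w
      rw [densityProd]
      calc _ ≤ ∏ j ∈ Finset.range n, (1 + c * expMass) := by
            refine Finset.prod_le_prod' fun j _ => ?_
            gcongr
            exact expDensity_le (by positivity) w
        _ = _ := by simp
    refine ne_top_of_le_ne_top ?_ (lintegral_mono hb)
    rw [lintegral_const, Measure.restrict_apply_univ]
    exact ENNReal.mul_ne_top (ENNReal.pow_ne_top (ENNReal.add_ne_top.2 ⟨one_ne_top,
      ENNReal.mul_ne_top hc expMass_lt_top.ne⟩)) hΩ
  set J := ∫⁻ w in Ω, densityProd S ρ c n w with hJ
  have hmain : J ≤ volume Ω + 2⁻¹ * J := by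
    refine (hstep n).trans ?_
    rw [← Finset.mul_sum]
    refine add_le_add le_rfl ?_
    calc _ ≤ c * expMass * (Λ * J) := mul_le_mul_right hsum _
      _ = c * expMass * Λ * J := by ring
      _ ≤ _ := mul_le_mul_left hcΛ _
  have h2 : 2⁻¹ * J ≠ ⊤ := ENNReal.mul_ne_top (by simp) hfin
  have h3 : J = 2⁻¹ * J + 2⁻¹ * J := by
    rw [← add_mul, ENNReal.inv_two_add_inv_two, one_mul]
  have h4 : 2⁻¹ * J ≤ volume Ω := by
    rw [h3, ← h3] at hmain
    conv_lhs at hmain => rw [h3]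
    exact (ENNReal.add_le_add_iff_right h2).1 hmain
  calc J = 2 * (2⁻¹ * J) := by
        rw [← mul_assoc, ENNReal.mul_inv_cancel two_ne_zero ofNat_ne_top, one_mul]
    _ ≤ _ := by gcongr

/-- Between the extreme admissible scales 4^k grows by at most 12/ε, and log 4 ≥ 1. This overlap
count is the source of the logarithm in the final exponent. -/
theorem card_scales_le {ε x : ℝ} (hε : 0 < ε) (hε1 : ε < 1) (n : ℕ) :
    (((Finset.range n).filter fun k => ε < 4 ^ (k + 1) * x ∧ 4 ^ k * x ≤ 3).card : ℝ) ≤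
      Real.log (12 / ε) + 1 := by
  set T := (Finset.range n).filter fun k => ε < 4 ^ (k + 1) * x ∧ 4 ^ k * x ≤ 3 with hT
  have hlog : 0 ≤ Real.log (12 / ε) := by
    apply Real.log_nonneg
    rw [le_div_iff₀ hε]
    linarith
  rcases T.eq_empty_or_nonempty with h | h
  · rw [h]
    simp only [Finset.card_empty, Nat.cast_zero]
    linarith
  · have h1 := Finset.min'_mem T h
    have h2 := Finset.max'_mem T h
    have hle := Finset.min'_le T _ h2
    set a := T.min' h
    set b := T.max' h
    have hsub : T ⊆ Finset.Icc a b := fun k hk =>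
      Finset.mem_Icc.2 ⟨Finset.min'_le T k hk, Finset.le_max' T k hk⟩
    have hcard : (T.card : ℝ) ≤ (b - a : ℕ) + 1 := by
      have := Finset.card_le_card hsub
      rw [Nat.card_Icc] at this
      have h3 : T.card ≤ (b - a) + 1 := by omega
      exact_mod_cast h3
    have h3 := (Finset.mem_filter.1 h1).2.1
    have h4 := (Finset.mem_filter.1 h2).2.2
    have h5 : (4 : ℝ) ^ b = 4 ^ a * 4 ^ (b - a) := by
      rw [← pow_add]; congr 1; omega
    have hx : 0 < 4 ^ a * x := by
      rw [pow_succ] at h3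
      linarith
    have h6 : (4 : ℝ) ^ (b - a) ≤ 12 / ε := by
      rw [le_div_iff₀ hε]
      have h7 : (4 : ℝ) ^ (b - a) * (4 ^ a * x) ≤ 3 := by
        rw [h5] at h4; linarith
      rw [pow_succ] at h3
      have : (0 : ℝ) < 4 ^ (b - a) := by positivity
      nlinarith
    have h7 : ((b - a : ℕ) : ℝ) ≤ Real.log (12 / ε) := by
      have h8 := Real.log_le_log (by positivity) h6
      rw [Real.log_pow] at h8
      have h9 : 1 ≤ Real.log 4 := by
        rw [Real.le_log_iff_exp_le (by norm_num)]
        linarith [Real.exp_one_lt_d9]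
      have : (0 : ℝ) ≤ (b - a : ℕ) := Nat.cast_nonneg _
      nlinarith
    linarith

/-- The logarithmic energy at `w` carried by the points of `Ω` whose distance to the complement
is at least `ε` times their distance to `w`. -/
noncomputable def thickEnergy (Ω : Set ℂ) (ε : ℝ) (w : ℂ) : ℝ≥0∞ :=
  ∫⁻ y in {y | y ∈ Ω ∧ ε * ‖y - w‖ < infDist y Ωᶜ ∧ infDist w Ωᶜ / 2 ≤ ‖y - w‖},
    ENNReal.ofReal ((‖y - w‖ ^ 2)⁻¹)

/-- Points of `Ω` at distance about `1 / (4 ^ k * ρ)` to the complement, up to the factor `ε`. -/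
def scaleLayer (Ω : Set ℂ) (ε ρ : ℝ) (k : ℕ) : Set ℂ :=
  {y | y ∈ Ω ∧ ε < 4 ^ (k + 1) * (ρ * infDist y Ωᶜ) ∧ 4 ^ k * (ρ * infDist y Ωᶜ) ≤ 3}

theorem measurableSet_scaleLayer {Ω : Set ℂ} (hΩ : IsOpen Ω) (ε ρ : ℝ) (k : ℕ) :
    MeasurableSet (scaleLayer Ω ε ρ k) := by
  have hd : Measurable fun y => infDist y Ωᶜ := (continuous_infDist_pt _).measurable
  have h1 : MeasurableSet {y | ε < 4 ^ (k + 1) * (ρ * infDist y Ωᶜ)} :=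
    measurableSet_lt (by fun_prop) (by fun_prop)
  have h2 : MeasurableSet {y | 4 ^ k * (ρ * infDist y Ωᶜ) ≤ 3} :=
    measurableSet_le (by fun_prop) (by fun_prop)
  exact hΩ.measurableSet.inter (h1.inter h2)

theorem measurableSet_thick {Ω : Set ℂ} (hΩ : IsOpen Ω) (ε : ℝ) (w : ℂ) : MeasurableSet
    {y | y ∈ Ω ∧ ε * ‖y - w‖ < infDist y Ωᶜ ∧ infDist w Ωᶜ / 2 ≤ ‖y - w‖} := by
  have hd : Measurable fun y => infDist y Ωᶜ := (continuous_infDist_pt _).measurable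
  have h1 : MeasurableSet {y | ε * ‖y - w‖ < infDist y Ωᶜ} :=
    measurableSet_lt (by fun_prop) (by fun_prop)
  have h2 : MeasurableSet {y | infDist w Ωᶜ / 2 ≤ ‖y - w‖} :=
    measurableSet_le (by fun_prop) (by fun_prop)
  exact hΩ.measurableSet.inter (h1.inter h2)

theorem infDist_compl_le_add (Ω : Set ℂ) (y w : ℂ) :
    infDist y Ωᶜ ≤ infDist w Ωᶜ + ‖y - w‖ := by
  rw [← dist_eq_norm]
  exact infDist_le_infDist_add_dist

/-- A thick point y with 4^k ρ|y-w| ≤ 1 < 4^{k+1} ρ|y-w| lies in layer k: thickness gives the lower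
bound, and the cutoff dist(w, Ωᶜ)/2 ≤ |y-w| gives dist(y, Ωᶜ) ≤ 3|y-w|. There |y-w|⁻² is at most 16e
times the kernel of scale k, the 16 from the ratio of scales and the e from exp(-1). -/
theorem thickEnergy_le_sum {Ω : Set ℂ} (hΩ : IsOpen Ω) {ε ρ : ℝ} (hε : 0 < ε) (hρ : 0 < ρ)
    {w : ℂ} (hdw : 0 < infDist w Ωᶜ) (hdiam : ∀ y ∈ Ω, ρ * ‖y - w‖ ≤ 1) {n : ℕ}
    (hn : 2 < 4 ^ n * (ρ * infDist w Ωᶜ)) :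
    thickEnergy Ω ε w ≤ ENNReal.ofReal (16 * Real.exp 1) *
      ∑ k ∈ Finset.range n, expDensity (scaleLayer Ω ε ρ k) (4 ^ k * ρ) w := by
  have hmeas : ∀ k, MeasurableSet (scaleLayer Ω ε ρ k) := measurableSet_scaleLayer hΩ ε ρ
  simp_rw [expDensity, ← lintegral_indicator (hmeas _)]
  rw [← lintegral_finsetSum, ← lintegral_const_mul, thickEnergy, ← lintegral_indicator]
  · refine lintegral_mono fun y => ?_
    by_cases hy : y ∈ {y | y ∈ Ω ∧ ε * ‖y - w‖ < infDist y Ωᶜ ∧ infDist w Ωᶜ / 2 ≤ ‖y - w‖}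
    swap
    · rw [indicator_of_notMem hy]; exact zero_le
    rw [indicator_of_mem hy]
    obtain ⟨hyΩ, hy1, hy2⟩ := hy
    set x := ‖y - w‖ with hx
    have hx0 : 0 < x := by linarith
    have h1 : 1 ≤ (ρ * x)⁻¹ := (one_le_inv₀ (by positivity)).2 (hdiam y hyΩ)
    obtain ⟨k, hk1, hk2⟩ := exists_nat_pow_near h1 (by norm_num : (1 : ℝ) < 4)
    rw [le_inv_comm₀ (by positivity) (by positivity), ← one_div, le_div_iff₀ (by positivity)]
      at hk1
    rw [inv_lt_comm₀ (by positivity) (by positivity), ← one_div, div_lt_iff₀ (by positivity)]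
      at hk2
    have hkn : k < n := by
      by_contra! hcon
      have : (4 : ℝ) ^ n ≤ 4 ^ k := pow_le_pow_right₀ (by norm_num) hcon
      have h2 : (4 : ℝ) ^ n * (ρ * infDist w Ωᶜ) ≤ 4 ^ k * (ρ * (2 * x)) := by
        gcongr
        linarith
      linarith
    have hmem : y ∈ scaleLayer Ω ε ρ k := by
      refine ⟨hyΩ, ?_, ?_⟩
      · have : ε * (ρ * x * 4 ^ (k + 1)) < 4 ^ (k + 1) * (ρ * infDist y Ωᶜ) := by
          have : (0 : ℝ) < 4 ^ (k + 1) * ρ := by positivity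
          nlinarith
        nlinarith
      · have h3 := infDist_compl_le_add Ω y w
        have h4 : infDist y Ωᶜ ≤ 3 * x := by linarith
        calc 4 ^ k * (ρ * infDist y Ωᶜ) ≤ 4 ^ k * (ρ * (3 * x)) := by gcongr
          _ ≤ 3 := by linarith
    refine le_trans ?_ (mul_le_mul_right (Finset.single_le_sum (fun _ _ => zero_le)
      (Finset.mem_range.2 hkn)) _)
    rw [indicator_of_mem hmem, ← ENNReal.ofReal_mul (by positivity)]
    apply ENNReal.ofReal_le_ofReal
    rw [norm_sub_rev w y, ← hx]
    have h5 : Real.exp (-1) ≤ Real.exp (-(4 ^ k * ρ * x)) := Real.exp_le_exp.2 (by linarith)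
    have h6 : Real.exp 1 * Real.exp (-1) = 1 := by rw [← Real.exp_add]; simp
    have h7 : 1 ≤ 16 * ((4 ^ k * ρ) ^ 2 * x ^ 2) := by
      have : 1 ≤ (4 * (4 ^ k * ρ * x)) ^ 2 := by
        apply one_le_pow₀
        rw [pow_succ] at hk2
        linarith
      nlinarith
    have h8 : (x ^ 2)⁻¹ ≤ 16 * (4 ^ k * ρ) ^ 2 := by
      rw [inv_le_iff_one_le_mul₀ (by positivity)]
      linarith
    calc (x ^ 2)⁻¹ ≤ 16 * (4 ^ k * ρ) ^ 2 := h8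
      _ = 16 * (Real.exp 1 * Real.exp (-1)) * (4 ^ k * ρ) ^ 2 := by rw [h6]; ring
      _ ≤ 16 * (Real.exp 1 * Real.exp (-(4 ^ k * ρ * x))) * (4 ^ k * ρ) ^ 2 := by gcongr
      _ = _ := by ring
  · exact measurableSet_thick hΩ ε w
  · exact Finset.measurable_fun_sum _ fun k _ => Measurable.indicator (by fun_prop) (hmeas k)
  · exact fun k _ => Measurable.indicator (by fun_prop) (hmeas k)

/-- Factor by factor, from e^u ≤ 1 + 2u on [0, 1]; the densities are bounded by `expMass`. -/
theorem exp_mul_sum_le_densityProd {S : ℕ → Set ℂ} {ρ t : ℝ} (hρ : 0 < ρ) (ht : 0 ≤ t)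
    (ht1 : t * expMass.toReal ≤ 1) (n : ℕ) (w : ℂ) :
    ENNReal.ofReal (Real.exp (t * (∑ k ∈ Finset.range n,
      expDensity (S k) (4 ^ k * ρ) w).toReal)) ≤
      densityProd S ρ (ENNReal.ofReal (2 * t)) n w := by
  have hfin : ∀ k, expDensity (S k) (4 ^ k * ρ) w ≠ ⊤ := fun k =>
    ne_top_of_le_ne_top expMass_lt_top.ne (expDensity_le (by positivity) w)
  rw [ENNReal.toReal_sum fun k _ => hfin k, Finset.mul_sum, Real.exp_sum,
    ENNReal.ofReal_prod_of_nonneg fun _ _ => (Real.exp_pos _).le, densityProd]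
  refine Finset.prod_le_prod' fun k _ => ?_
  set x := (expDensity (S k) (4 ^ k * ρ) w).toReal with hx
  have hx0 : 0 ≤ x := ENNReal.toReal_nonneg
  have hx1 : t * x ≤ 1 := by
    refine le_trans ?_ ht1
    exact mul_le_mul_of_nonneg_left (ENNReal.toReal_mono expMass_lt_top.ne
      (expDensity_le (by positivity) w)) ht
  rw [← ENNReal.ofReal_toReal (hfin k), ← hx, ← ENNReal.ofReal_mul (by positivity),
    ← ENNReal.ofReal_one, ← ENNReal.ofReal_add (by norm_num) (by positivity)]
  apply ENNReal.ofReal_le_ofReal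
  have h0 : 0 ≤ t * x := by positivity
  have := Real.abs_exp_sub_one_le (x := t * x) (by rw [abs_of_nonneg h0]; exact hx1)
  rw [abs_of_nonneg h0] at this
  linarith [(abs_le.1 this).2]

/-- Exponential integrability of the thick part of the logarithmic energy. -/
theorem exists_lintegral_exp_thickEnergy_le :
    ∃ s : ℝ, 0 < s ∧ ∀ Ω : Set ℂ, IsOpen Ω → Bornology.IsBounded Ω → ∀ ε : ℝ, 0 < ε → ε < 1 →
      (∀ w ∈ Ω, thickEnergy Ω ε w < ⊤) ∧
      ∫⁻ w in Ω, ENNReal.ofReal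
        (Real.exp (s / (Real.log (12 / ε) + 1) * (thickEnergy Ω ε w).toReal)) ≤
          2 * volume Ω := by
  have hA : 0 < 16 * Real.exp 1 := by positivity
  have hM : 0 < expMass.toReal := ENNReal.toReal_pos expMass_pos.ne' expMass_lt_top.ne
  -- 16e is the loss in `thickEnergy_le_sum`; the rest makes c·Λ·`expMass` = 1/2 for c = 2t and Λ =
  -- l below.
  refine ⟨1 / (4 * expMass.toReal * (16 * Real.exp 1)), by positivity, ?_⟩
  intro Ω hΩ hb ε hε hε1
  obtain ⟨R, hR0, hR⟩ := hb.subset_closedBall_lt 0 0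
  set ρ := (2 * R)⁻¹ with hρd
  have hρ : 0 < ρ := by positivity
  have hdiam : ∀ w ∈ Ω, ∀ y ∈ Ω, ρ * ‖y - w‖ ≤ 1 := by
    intro w hw y hy
    have h1 := hR hw
    have h2 := hR hy
    rw [mem_closedBall_zero_iff] at h1 h2
    rw [hρd, inv_mul_le_iff₀ (by positivity)]
    linarith [norm_sub_le y w]
  have hcompl : (Ωᶜ).Nonempty := by
    rw [nonempty_compl]
    rintro rfl
    exact NormedSpace.unbounded_univ ℝ ℂ hb
  have hd : ∀ w ∈ Ω, 0 < infDist w Ωᶜ := by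
    intro w hw
    rw [← hΩ.isClosed_compl.notMem_iff_infDist_pos hcompl]
    simpa using hw
  have hlog : 0 < Real.log (12 / ε) := by
    apply Real.log_pos
    rw [lt_div_iff₀ hε]
    linarith
  set l := Real.log (12 / ε) + 1 with hl
  have hl1 : 1 ≤ l := by linarith
  set t := 1 / (4 * expMass.toReal * l) with ht
  have ht0 : 0 < t := by positivity
  have hscale : ∀ w ∈ Ω, ∃ n : ℕ, 2 < 4 ^ n * (ρ * infDist w Ωᶜ) := by
    intro w hw
    have := hd w hw
    obtain ⟨n, hn⟩ := pow_unbounded_of_one_lt (2 / (ρ * infDist w Ωᶜ))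
      (by norm_num : (1 : ℝ) < 4)
    exact ⟨n, (div_lt_iff₀ (by positivity)).1 hn⟩
  set S := scaleLayer Ω ε ρ with hS
  have hfin : ∀ n w, ∑ k ∈ Finset.range n, expDensity (S k) (4 ^ k * ρ) w ≠ ⊤ := fun n w =>
    ENNReal.sum_ne_top.2 fun k _ =>
      ne_top_of_le_ne_top expMass_lt_top.ne (expDensity_le (by positivity) w)
  constructor
  · intro w hw
    obtain ⟨n, hn⟩ := hscale w hw
    exact (thickEnergy_le_sum hΩ hε hρ (hd w hw) (hdiam w hw) hn).trans_lt
      (ENNReal.mul_lt_top ENNReal.ofReal_lt_top (hfin n w).lt_top)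
  have hprod : ∀ n, ∫⁻ w in Ω, densityProd S ρ (ENNReal.ofReal (2 * t)) n w ≤ 2 * volume Ω := by
    intro n
    refine lintegral_densityProd_le (Λ := ENNReal.ofReal l) hρ ENNReal.ofReal_ne_top
      hb.measure_lt_top.ne (measurableSet_scaleLayer hΩ ε ρ) (fun k y hy => hy.1) ?_ ?_
    · intro y
      refine le_trans ?_ (ENNReal.ofReal_le_ofReal
        (card_scales_le (x := ρ * infDist y Ωᶜ) hε hε1 n))
      rw [ENNReal.ofReal_natCast, Finset.card_filter, Nat.cast_sum]
      refine Finset.sum_le_sum fun k _ => ?_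
      by_cases hy : y ∈ S k
      · rw [indicator_of_mem hy, if_pos hy.2]
        simp
      · rw [indicator_of_notMem hy]
        exact zero_le
    · rw [← ENNReal.ofReal_toReal expMass_lt_top.ne, ← ENNReal.ofReal_mul (by positivity),
        ← ENNReal.ofReal_mul (by positivity)]
      refine ENNReal.ofReal_le_of_le_toReal (le_of_eq ?_)
      rw [ht, ENNReal.toReal_inv, ENNReal.toReal_ofNat]
      field_simp
      norm_num
  calc ∫⁻ w in Ω, ENNReal.ofReal (Real.exp (1 / (4 * expMass.toReal * (16 * Real.exp 1)) / l *
        (thickEnergy Ω ε w).toReal))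
      ≤ ∫⁻ w in Ω, ⨆ n, densityProd S ρ (ENNReal.ofReal (2 * t)) n w := by
        refine setLIntegral_mono' hΩ.measurableSet fun w hw => ?_
        obtain ⟨n, hn⟩ := hscale w hw
        refine le_trans ?_ (le_iSup _ n)
        refine le_trans (ENNReal.ofReal_le_ofReal (Real.exp_le_exp.2 ?_))
          (exp_mul_sum_le_densityProd hρ ht0.le ?_ n w)
        · have h1 := ENNReal.toReal_mono (ENNReal.mul_ne_top ENNReal.ofReal_ne_top (hfin n w))
            (thickEnergy_le_sum hΩ hε hρ (hd w hw) (hdiam w hw) hn)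
          rw [ENNReal.toReal_mul, ENNReal.toReal_ofReal hA.le] at h1
          calc _ ≤ 1 / (4 * expMass.toReal * (16 * Real.exp 1)) / l *
                (16 * Real.exp 1 * (∑ k ∈ Finset.range n,
                  expDensity (S k) (4 ^ k * ρ) w).toReal) := by gcongr
            _ = _ := by
              rw [ht, ← mul_assoc]
              congr 1
              field_simp
        · rw [ht, div_mul_eq_mul_div, one_mul, div_le_one (by positivity)]
          nlinarith
    _ = ⨆ n, ∫⁻ w in Ω, densityProd S ρ (ENNReal.ofReal (2 * t)) n w :=
        lintegral_iSup (fun n => measurable_densityProd S ρ _ n)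
          (fun m n hmn w => densityProd_mono S ρ _ w hmn)
    _ ≤ _ := iSup_le hprod

end Energy

/-! ### Polar coordinates and circle averages. -/

open Real in
theorem intervalIntegral_circleMap_eq {E : Type*} [NormedAddCommGroup E] [NormedSpace ℝ E]
    (f : ℂ → E) (c : ℂ) (r : ℝ) :
    ∫ θ in Ioo (-π) π, f (circleMap c r θ) = (2 * π) • circleAverage f c r := by
  rw [circleAverage_eq_integral_add (-π), intervalIntegral.integral_comp_add_right
    (fun θ => f (circleMap c r θ)), smul_smul, mul_inv_cancel₀ (by positivity), one_smul,
    ← integral_Ioc_eq_integral_Ioo, ← intervalIntegral.integral_of_le (by linarith [pi_pos])]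
  congr 1 <;> ring

theorem polarCoord_symm_eq_circleMap (p : ℝ × ℝ) :
    Complex.polarCoord.symm p = circleMap 0 p.1 p.2 := by
  rw [Complex.polarCoord_symm_apply, circleMap, zero_add, Complex.exp_mul_I]
  push_cast
  rfl

open Real in
/-- Integration in polar coordinates in terms of circle averages. -/
theorem integral_eq_integral_circleAverage {E : Type*} [NormedAddCommGroup E] [NormedSpace ℝ E]
    {f : ℂ → E} (hf : Integrable f) :
    ∫ z, f z = ∫ r in Ioi (0 : ℝ), (2 * π * r) • circleAverage f 0 r := by
  have hint : IntegrableOn (fun p : ℝ × ℝ => p.1 • f (Complex.polarCoord.symm p))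
      (Ioi 0 ×ˢ Ioo (-π) π) := by
    have h1 : Integrable (fun p : ℝ × ℝ => f (Complex.measurableEquivRealProd.symm p)) :=
      (Complex.volume_preserving_equiv_real_prod.symm).integrable_comp_emb
        Complex.measurableEquivRealProd.symm.measurableEmbedding |>.2 hf
    have h2 := h1.integrableOn (s := polarCoord.symm '' polarCoord.target)
    rw [integrableOn_image_iff_integrableOn_abs_det_fderiv_smul volume
      polarCoord.open_target.measurableSet
      (fun p _ => (hasFDerivAt_polarCoord_symm p).hasFDerivWithinAt)
      polarCoord.symm.injOn] at h2
    simp_rw [det_fderivPolarCoordSymm] at h2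
    refine h2.congr_fun (fun p hp => ?_) polarCoord.open_target.measurableSet
    simp only
    rw [abs_of_pos (show 0 < p.1 from hp.1)]
    rfl
  rw [← Complex.integral_comp_polarCoord_symm, polarCoord_target, Measure.volume_eq_prod,
    setIntegral_prod _ (by rwa [← Measure.volume_eq_prod])]
  refine setIntegral_congr_fun measurableSet_Ioi fun r _ => ?_
  simp only [polarCoord_symm_eq_circleMap]
  rw [integral_smul, intervalIntegral_circleMap_eq, smul_smul, mul_comm r]

open Real in
theorem lintegral_eq_lintegral_polar (f : ℂ → ENNReal) (hf : Measurable f) :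
    ∫⁻ z, f z = ∫⁻ r in Ioi (0 : ℝ), ∫⁻ θ in Ioo (-π) π,
      ENNReal.ofReal r * f (circleMap 0 r θ) := by
  rw [← Complex.lintegral_comp_polarCoord_symm, polarCoord_target, Measure.volume_eq_prod]
  simp only [polarCoord_symm_eq_circleMap, smul_eq_mul]
  rw [setLIntegral_prod (hf := ?_)]
  refine (Measurable.mul (by fun_prop) (hf.comp ?_)).aemeasurable
  have : Continuous fun p : ℝ × ℝ => circleMap 0 p.1 p.2 := by
    simp only [circleMap]; fun_prop
  exact this.measurable

theorem setIntegral_ball_eq_integral_circleAverage {f : ℂ → ℂ} {c : ℂ} {R : ℝ}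
    (hf : IntegrableOn f (ball c R)) :
    ∫ z in ball c R, f z = ∫ r in Ioo 0 R, (2 * Real.pi * r) • Real.circleAverage f c r := by
  rw [← integral_indicator measurableSet_ball,
    ← integral_add_right_eq_self _ c, integral_eq_integral_circleAverage
      ((hf.integrable_indicator measurableSet_ball).comp_add_right c), ← Ioi_inter_Iio,
    ← setIntegral_indicator measurableSet_Iio]
  refine setIntegral_congr_fun measurableSet_Ioi fun r hr => ?_
  rw [Real.circleAverage_map_add_const (f := (ball c R).indicator f)]
  rw [mem_Ioi] at hr
  by_cases h : r < R
  · rw [indicator_of_mem (show r ∈ Iio R from h)]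
    congr 1
    refine Real.circleAverage_congr_sphere fun z hz => ?_
    rw [mem_sphere, abs_of_pos hr] at hz
    exact indicator_of_mem (by rw [mem_ball, hz]; exact h) f
  · rw [indicator_of_notMem (show r ∉ Iio R from h)]
    have : Real.circleAverage ((ball c R).indicator f) c r =
        Real.circleAverage (fun _ => (0 : ℂ)) c r := by
      refine Real.circleAverage_congr_sphere fun z hz => ?_
      rw [mem_sphere, abs_of_pos hr] at hz
      exact indicator_of_notMem (by rw [mem_ball, hz]; exact h) f
    rw [this, Real.circleAverage_const, smul_zero]

/-! ### Reproducing formulas for the integrated Bergman kernel. -/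

/-- On the circle of radius `r`, the antiholomorphic kernel `a / (1 - a * conj z)` is a Cauchy
kernel. -/
theorem bergman_kernel_on_sphere {a z : ℂ} {r : ℝ} (hr : 0 < r) (hr1 : r < 1) (ha : ‖a‖ < 1)
    (hz : ‖z‖ = r) : a / (1 - a * starRingEnd ℂ z) = a * (z / (z - r ^ 2 * a)) ∧
      z - r ^ 2 * a ≠ 0 := by
  have hz0 : z ≠ 0 := by
    rintro rfl
    rw [norm_zero] at hz
    linarith
  have hzz : z * starRingEnd ℂ z = r ^ 2 := by
    rw [Complex.mul_conj, Complex.normSq_eq_norm_sq, hz]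
    push_cast
    rfl
  have h1 : z - r ^ 2 * a = z * (1 - a * starRingEnd ℂ z) := by
    rw [← hzz]; ring
  have h2 : 1 - a * starRingEnd ℂ z ≠ 0 := by
    intro h
    have h3 : ‖a * starRingEnd ℂ z‖ = 1 := by
      rw [← sub_eq_zero.1 h, norm_one]
    rw [norm_mul, Complex.norm_conj, hz] at h3
    nlinarith [norm_nonneg a]
  refine ⟨?_, by rw [h1]; exact mul_ne_zero hz0 h2⟩
  rw [h1]
  field_simp

theorem sq_mul_mem_ball {a : ℂ} {r : ℝ} (hr : 0 < r) (hr1 : r < 1) (ha : ‖a‖ < 1) :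
    (r ^ 2 * a : ℂ) ∈ ball (0 : ℂ) |r| := by
  rw [mem_ball_zero_iff, norm_mul, norm_pow, Complex.norm_real, Real.norm_eq_abs, abs_of_pos hr]
  nlinarith [norm_nonneg a, mul_pos hr (sub_pos.2 hr1)]

theorem circleAverage_bergman_mul {g : ℂ → ℂ} {a : ℂ} {r : ℝ} (hr : 0 < r) (hr1 : r < 1)
    (ha : ‖a‖ < 1) (hg : DiffContOnCl ℂ g (ball 0 r)) :
    Real.circleAverage (fun z => a / (1 - a * starRingEnd ℂ z) * g z) 0 r =
      a * g (r ^ 2 * a) := by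
  rw [← abs_of_pos hr] at hg
  rw [← hg.circleAverage_smul_div (sq_mul_mem_ball hr hr1 ha), ← smul_eq_mul,
    ← Real.circleAverage_fun_smul]
  refine Real.circleAverage_congr_sphere fun z hz => ?_
  rw [mem_sphere_zero_iff_norm, abs_of_pos hr] at hz
  simp only [(bergman_kernel_on_sphere hr hr1 ha hz).1, smul_eq_mul, sub_zero]
  ring

/-- On this circle the integrand is a multiple of the difference of two Cauchy kernels, with poles a
and r²a both inside, and their averages cancel. -/
theorem circleAverage_bergman_mul_pole {a : ℂ} {r : ℝ} (hr : ‖a‖ < r) (hr1 : r < 1) :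
    Real.circleAverage (fun z => a / (1 - a * starRingEnd ℂ z) * (z - a)⁻¹) 0 r = 0 := by
  have hr0 : 0 < r := (norm_nonneg a).trans_lt hr
  have ha : ‖a‖ < 1 := hr.trans hr1
  have hr2 : (1 - r ^ 2 : ℂ) ≠ 0 := by
    have : (1 - r ^ 2 : ℝ) ≠ 0 := by nlinarith
    exact_mod_cast this
  have hone : DiffContOnCl ℂ (fun _ : ℂ => (1 : ℂ)) (ball 0 |r|) := diffContOnCl_const
  have h1 := hone.circleAverage_smul_div (sq_mul_mem_ball hr0 hr1 ha)
  have h2 := hone.circleAverage_smul_div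
    (show a ∈ ball (0 : ℂ) |r| by rwa [mem_ball_zero_iff, abs_of_pos hr0])
  have hza : ∀ z ∈ sphere (0 : ℂ) |r|, z - a ≠ 0 := by
    intro z hz h
    rw [mem_sphere_zero_iff_norm, abs_of_pos hr0, sub_eq_zero.1 h] at hz
    linarith
  have hzw : ∀ z ∈ sphere (0 : ℂ) |r|, z - r ^ 2 * a ≠ 0 := fun z hz =>
    (bergman_kernel_on_sphere hr0 hr1 ha
      (by rwa [mem_sphere_zero_iff_norm, abs_of_pos hr0] at hz)).2
  have hci : ∀ w : ℂ, (∀ z ∈ sphere (0 : ℂ) |r|, z - w ≠ 0) →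
      CircleIntegrable (fun z : ℂ => ((z - 0) / (z - w)) • (1 : ℂ)) 0 r := by
    intro w hw
    apply ContinuousOn.circleIntegrable'
    exact ((continuousOn_id.sub continuousOn_const).div
      (continuousOn_id.sub continuousOn_const) hw).smul continuousOn_const
  have h3 := Real.circleAverage_fun_sub (hci a hza) (hci _ hzw)
  rw [h1, h2, sub_self] at h3
  have h4 : Real.circleAverage (fun z => a / (1 - a * starRingEnd ℂ z) * (z - a)⁻¹) 0 r =
      Real.circleAverage (fun z => (1 - r ^ 2 : ℂ)⁻¹ •
        (((z - 0) / (z - a)) • (1 : ℂ) - ((z - 0) / (z - r ^ 2 * a)) • (1 : ℂ))) 0 r := by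
    refine Real.circleAverage_congr_sphere fun z hz => ?_
    have e1 := hza z hz
    have e2 := hzw z hz
    rw [mem_sphere_zero_iff_norm, abs_of_pos hr0] at hz
    simp only [(bergman_kernel_on_sphere hr0 hr1 ha hz).1, smul_eq_mul, sub_zero, mul_one]
    rw [eq_comm, inv_mul_eq_iff_eq_mul₀ hr2, div_sub_div _ _ e1 e2,
      div_eq_iff (mul_ne_zero e1 e2)]
    have e3 : (z - a)⁻¹ * (z - a) = 1 := inv_mul_cancel₀ e1
    have e4 : z / (z - r ^ 2 * a) * (z - r ^ 2 * a) = z := div_mul_cancel₀ z e2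
    calc z * (z - r ^ 2 * a) - (z - a) * z = (1 - r ^ 2) * a * z * 1 := by ring
      _ = (1 - r ^ 2) * a * (z / (z - r ^ 2 * a) * (z - r ^ 2 * a)) * ((z - a)⁻¹ * (z - a)) := by
        rw [e3, e4]
      _ = _ := by ring
  rw [h4, Real.circleAverage_fun_smul, h3, smul_zero]

theorem norm_sq_mul_lt_one {a : ℂ} {s : ℝ} (ha : ‖a‖ < 1) (h0 : 0 ≤ s) (h1 : s ≤ 1) :
    (s ^ 2 * a : ℂ) ∈ ball (0 : ℂ) 1 := by
  rw [mem_ball_zero_iff, norm_mul, norm_pow, Complex.norm_real, Real.norm_eq_abs, abs_of_nonneg h0]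
  nlinarith [norm_nonneg a, pow_le_one₀ h0 h1 (n := 2)]

/-- The Bergman reproducing formula, integrated along the segment from `0` to `a`. -/
theorem integral_bergman_mul {g Γ : ℂ → ℂ} {a : ℂ} (ha : ‖a‖ < 1)
    (hg : DifferentiableOn ℂ g (ball 0 1)) (hΓ : ∀ z ∈ ball (0 : ℂ) 1, HasDerivAt Γ (g z) z)
    (hint : IntegrableOn (fun z => a / (1 - a * starRingEnd ℂ z) * g z) (ball 0 1)) :
    ∫ z in ball (0 : ℂ) 1, a / (1 - a * starRingEnd ℂ z) * g z = Real.pi * (Γ a - Γ 0) := by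
  rw [setIntegral_ball_eq_integral_circleAverage hint]
  -- The radial integrand 2πr · a g(r²a) is the derivative of π Γ(r²a).
  have hd : ∀ s ∈ uIcc (0 : ℝ) 1,
      HasDerivAt (fun s : ℝ => Real.pi * Γ (s ^ 2 * a)) ((2 * Real.pi * s) • (a * g (s ^ 2 * a))) s := by
    intro s hs
    rw [uIcc_of_le zero_le_one] at hs
    have e1 : HasDerivAt (fun s : ℝ => (s ^ 2 * a : ℂ)) (2 * s * a) s := by
      have := (((hasDerivAt_id (s : ℂ)).comp_ofReal).fun_pow 2).mul_const a
      simpa using this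
    have e2 := ((hΓ _ (norm_sq_mul_lt_one ha hs.1 hs.2)).comp s e1).const_mul (Real.pi : ℂ)
    refine e2.congr_deriv ?_
    rw [Complex.real_smul]
    push_cast
    ring
  have hc : ContinuousOn (fun s : ℝ => (2 * Real.pi * s) • (a * g (s ^ 2 * a))) (uIcc 0 1) := by
    rw [uIcc_of_le zero_le_one]
    have : ContinuousOn (fun s : ℝ => g (s ^ 2 * a)) (Icc 0 1) :=
      hg.continuousOn.comp (by fun_prop) fun s hs => norm_sq_mul_lt_one ha hs.1 hs.2
    have hm : ContinuousOn (fun s : ℝ => 2 * Real.pi * s) (Icc 0 1) := by fun_prop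
    exact hm.smul (continuousOn_const.mul this)
  have hftc := intervalIntegral.integral_eq_sub_of_hasDerivAt hd hc.intervalIntegrable
  rw [intervalIntegral.integral_of_le zero_le_one, integral_Ioc_eq_integral_Ioo] at hftc
  simp only [Complex.ofReal_one, one_pow, one_mul, Complex.ofReal_zero, ne_eq, OfNat.ofNat_ne_zero,
    not_false_eq_true, zero_pow, zero_mul] at hftc
  rw [mul_sub, ← hftc]
  refine setIntegral_congr_fun measurableSet_Ioo fun r hr => ?_
  rw [circleAverage_bergman_mul hr.1 hr.2 ha]
  refine (hg.mono ?_).diffContOnCl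
  rw [closure_ball _ hr.1.ne']
  exact closedBall_subset_ball hr.2

/-- Circles of radius r > |a| contribute nothing. Those with r < |a| contribute -2πr/(1-r²), an
exact derivative. This is where the term log(1-|a|²) comes from. -/
theorem integral_bergman_mul_pole {a : ℂ} (ha : ‖a‖ < 1)
    (hint : IntegrableOn (fun z => a / (1 - a * starRingEnd ℂ z) * (z - a)⁻¹) (ball 0 1)) :
    ∫ z in ball (0 : ℂ) 1, a / (1 - a * starRingEnd ℂ z) * (z - a)⁻¹ =
      Real.pi * Real.log (1 - ‖a‖ ^ 2) := by
  rcases eq_or_ne a 0 with rfl | ha0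
  · simp
  have hna : 0 < ‖a‖ := norm_pos_iff.2 ha0
  rw [setIntegral_ball_eq_integral_circleAverage hint]
  have hpos : ∀ s ∈ Icc 0 ‖a‖, 0 < 1 - s ^ 2 := fun s hs => by nlinarith [hs.1, hs.2]
  have hd : ∀ s ∈ uIcc (0 : ℝ) ‖a‖,
      HasDerivAt (fun s : ℝ => Real.pi * Real.log (1 - s ^ 2))
        (-(2 * Real.pi * s / (1 - s ^ 2))) s := by
    intro s hs
    rw [uIcc_of_le hna.le] at hs
    have e1 : HasDerivAt (fun s : ℝ => 1 - s ^ 2) (-(2 * s)) s := by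
      simpa using ((hasDerivAt_id s).fun_pow 2).const_sub 1
    refine ((e1.log (hpos s hs).ne').const_mul Real.pi).congr_deriv ?_
    ring
  have hc : ContinuousOn (fun s : ℝ => -(2 * Real.pi * s / (1 - s ^ 2))) (uIcc 0 ‖a‖) := by
    rw [uIcc_of_le hna.le]
    exact (ContinuousOn.div (by fun_prop) (by fun_prop) fun s hs => (hpos s hs).ne').neg
  have hftc := intervalIntegral.integral_eq_sub_of_hasDerivAt hd hc.intervalIntegrable
  rw [intervalIntegral.integral_of_le hna.le, integral_Ioc_eq_integral_Ioo] at hftc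
  simp only [ne_eq, OfNat.ofNat_ne_zero, not_false_eq_true, zero_pow, sub_zero, Real.log_one,
    mul_zero] at hftc
  rw [← Complex.ofReal_mul, ← hftc, ← integral_complex_ofReal]
  have hsplit : Ioo 0 ‖a‖ = Ioo 0 1 ∩ Iio ‖a‖ := by
    ext x
    simp only [mem_Ioo, mem_inter_iff, mem_Iio]
    exact ⟨fun h => ⟨⟨h.1, h.2.trans ha⟩, h.2⟩, fun h => ⟨h.1.1, h.2⟩⟩
  rw [hsplit, ← setIntegral_indicator measurableSet_Iio]
  have hae : ∀ᵐ r : ℝ, r ≠ ‖a‖ := by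
    rw [ae_iff]
    simp
  refine setIntegral_congr_ae measurableSet_Ioo ?_
  filter_upwards [hae] with r hne hr
  rcases lt_or_gt_of_ne hne with h | h
  · rw [indicator_of_mem (show r ∈ Iio ‖a‖ from h)]
    have hdc : DiffContOnCl ℂ (fun z => (z - a)⁻¹) (ball 0 r) := by
      refine DifferentiableOn.diffContOnCl ?_
      rw [closure_ball _ hr.1.ne']
      refine (differentiableOn_id.sub_const a).inv fun z hz hza => ?_
      rw [mem_closedBall_zero_iff, show z = a from sub_eq_zero.1 hza] at hz
      linarith
    rw [circleAverage_bergman_mul hr.1 hr.2 ha hdc, Complex.real_smul]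
    have hr2 : (1 - r ^ 2 : ℂ) ≠ 0 := by
      have : (1 - r ^ 2 : ℝ) ≠ 0 := by nlinarith [hr.1, hr.2]
      exact_mod_cast this
    have hr3 : (r ^ 2 * a - a : ℂ) = -(a * (1 - r ^ 2)) := by ring
    rw [hr3]
    push_cast
    field_simp
  · rw [indicator_of_notMem (show r ∉ Iio ‖a‖ from not_lt.2 h.le),
      circleAverage_bergman_mul_pole h hr.2, smul_zero]

/-- On |w - c| = r one has 1/(w-c) = conj(w-c)/r², so the integrand is a multiple of the conjugate
of h(w)(w-c), whose mean value is 0. It allows a disc around the pole to be cut out at no cost. -/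
theorem integral_conj_div_sub_eq_zero {h : ℂ → ℂ} {c : ℂ} {R : ℝ}
    (hh : DifferentiableOn ℂ h (ball c R)) :
    ∫ w in ball c R, starRingEnd ℂ (h w) / (w - c) = 0 := by
  by_cases hint : IntegrableOn (fun w => starRingEnd ℂ (h w) / (w - c)) (ball c R)
  swap
  · exact integral_undef hint
  rw [setIntegral_ball_eq_integral_circleAverage hint]
  rw [setIntegral_congr_fun (g := fun _ => (0 : ℂ)) measurableSet_Ioo, integral_zero]
  intro r hr
  simp only
  have hdc : DiffContOnCl ℂ (fun w => h w * (w - c)) (ball c |r|) := by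
    rw [abs_of_pos hr.1]
    refine DifferentiableOn.diffContOnCl ?_
    rw [closure_ball _ hr.1.ne']
    exact ((hh.mono (closedBall_subset_ball hr.2)).mul (by fun_prop))
  have h1 := hdc.circleAverage
  rw [sub_self, mul_zero] at h1
  have hci : CircleIntegrable (fun w => h w * (w - c)) c r := by
    apply ContinuousOn.circleIntegrable'
    refine hdc.continuousOn.mono ?_
    rw [closure_ball _ (abs_pos.2 hr.1.ne').ne']
    exact sphere_subset_closedBall
  have h2 := Complex.conjCLE.toContinuousLinearMap.circleAverage_comp_comm hci
  rw [h1, map_zero] at h2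
  have h3 : Real.circleAverage (fun w => starRingEnd ℂ (h w) / (w - c)) c r =
      Real.circleAverage (fun w => ((r : ℂ) ^ 2)⁻¹ •
        (Complex.conjCLE.toContinuousLinearMap ∘ fun w => h w * (w - c)) w) c r := by
    refine Real.circleAverage_congr_sphere fun w hw => ?_
    rw [mem_sphere, dist_eq_norm, abs_of_pos hr.1] at hw
    have h4 : (w - c) * starRingEnd ℂ (w - c) = r ^ 2 := by
      rw [Complex.mul_conj, Complex.normSq_eq_norm_sq, hw]
      push_cast
      rfl
    have h5 : w - c ≠ 0 := by
      intro h
      rw [h, norm_zero] at hw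
      linarith [hr.1]
    have h6 : (r : ℂ) ≠ 0 := by exact_mod_cast hr.1.ne'
    simp only [Function.comp_apply, ContinuousLinearEquiv.coe_coe, Complex.conjCLE_apply,
      map_mul, smul_eq_mul]
    rw [div_eq_iff h5, ← h4]
    have h7 : starRingEnd ℂ (w - c) ≠ 0 := (map_ne_zero _).2 h5
    field_simp
  rw [h3, Real.circleAverage_fun_smul]
  change (2 * Real.pi * r) • ((r : ℂ) ^ 2)⁻¹ • Real.circleAverage
    (Complex.conjCLE.toContinuousLinearMap ∘ fun w => h w * (w - c)) c r = 0
  rw [h2, smul_zero, smul_zero]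

/-! ### Holomorphic change of variables and integrability of a simple pole. -/

theorem det_restrictScalars_smulRight (c : ℂ) :
    ((ContinuousLinearMap.toSpanSingleton ℂ c).restrictScalars ℝ).det = ‖c‖ ^ 2 := by
  rw [ContinuousLinearMap.det, ← LinearMap.det_toMatrix Complex.basisOneI, Matrix.det_fin_two,
    ← Complex.normSq_eq_norm_sq, Complex.normSq_apply]
  simp [LinearMap.toMatrix_apply]

theorem lintegral_image_of_hasDerivAt {f f' : ℂ → ℂ} {s : Set ℂ} (hs : MeasurableSet s)
    (hf : ∀ z ∈ s, HasDerivAt f (f' z) z) (hi : InjOn f s) (F : ℂ → ENNReal) :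
    ∫⁻ w in f '' s, F w = ∫⁻ z in s, ENNReal.ofReal (‖f' z‖ ^ 2) * F (f z) := by
  rw [lintegral_image_eq_lintegral_abs_det_fderiv_mul volume hs
    (fun z hz => ((hf z hz).hasFDerivAt.restrictScalars ℝ).hasFDerivWithinAt) hi]
  simp_rw [det_restrictScalars_smulRight, abs_of_nonneg (sq_nonneg ‖f' _‖)]

theorem integral_image_of_hasDerivAt {f f' : ℂ → ℂ} {s : Set ℂ} (hs : MeasurableSet s)
    (hf : ∀ z ∈ s, HasDerivAt f (f' z) z) (hi : InjOn f s) (F : ℂ → ℂ) :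
    ∫ w in f '' s, F w = ∫ z in s, (‖f' z‖ ^ 2) • F (f z) := by
  rw [integral_image_eq_integral_abs_det_fderiv_smul volume hs
    (fun z hz => ((hf z hz).hasFDerivAt.restrictScalars ℝ).hasFDerivWithinAt) hi]
  simp_rw [det_restrictScalars_smulRight, abs_of_nonneg (sq_nonneg ‖f' _‖)]

theorem integrableOn_inv_sub (a : ℂ) (c : ℂ) (R : ℝ) :
    IntegrableOn (fun z : ℂ => (z - a)⁻¹) (ball c R) := by
  have h0 : IntegrableOn (fun z : ℂ => z⁻¹) (ball 0 (R + dist c a)) := by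
    refine ⟨by fun_prop, ?_⟩
    rw [HasFiniteIntegral, ← lintegral_indicator measurableSet_ball, lintegral_eq_lintegral_polar
      _ (Measurable.indicator (by fun_prop) measurableSet_ball)]
    set T := R + dist c a
    have hle : ∀ r ∈ Ioi (0 : ℝ), ∫⁻ θ in Ioo (-Real.pi) Real.pi, ENNReal.ofReal r *
        (ball 0 T).indicator (fun z : ℂ => ‖z⁻¹‖ₑ) (circleMap 0 r θ) ≤
        (Iio T).indicator (fun _ => ENNReal.ofReal (2 * Real.pi)) r := by
      intro r hr
      have hr' : 0 < r := hr
      have hn : ∀ θ, ‖circleMap 0 r θ‖ = r := fun θ => by simp [abs_of_pos hr']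
      by_cases h : r < T
      · rw [indicator_of_mem (show r ∈ Iio T from h)]
        have : ∀ θ, ENNReal.ofReal r *
            (ball 0 T).indicator (fun z : ℂ => ‖z⁻¹‖ₑ) (circleMap 0 r θ) = 1 := by
          intro θ
          rw [indicator_of_mem (by rw [mem_ball_zero_iff, hn]; exact h), ← ofReal_norm, norm_inv,
            hn, ← ENNReal.ofReal_mul hr'.le, mul_inv_cancel₀ hr'.ne', ENNReal.ofReal_one]
        simp_rw [this]
        rw [lintegral_one, Measure.restrict_apply_univ, Real.volume_Ioo]
        exact ENNReal.ofReal_le_ofReal (by linarith)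
      · rw [indicator_of_notMem (show r ∉ Iio T from h)]
        have : ∀ θ, ENNReal.ofReal r *
            (ball 0 T).indicator (fun z : ℂ => ‖z⁻¹‖ₑ) (circleMap 0 r θ) = 0 := by
          intro θ
          rw [indicator_of_notMem (by rw [mem_ball_zero_iff, hn]; exact h), mul_zero]
        simp [this]
    refine (setLIntegral_mono' measurableSet_Ioi hle).trans_lt ?_
    rw [setLIntegral_indicator measurableSet_Iio, setLIntegral_const, Iio_inter_Ioi,
      Real.volume_Ioo]
    exact ENNReal.mul_lt_top ENNReal.ofReal_lt_top ENNReal.ofReal_lt_top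
  have h1 := (h0.integrable_indicator measurableSet_ball).comp_sub_right a
  refine h1.integrableOn.congr_fun (fun z hz => ?_) measurableSet_ball
  refine indicator_of_mem ?_ _
  rw [mem_ball_zero_iff, ← dist_eq_norm]
  linarith [mem_ball.1 hz, dist_triangle z c a]

/-! ### The integral representation. -/

section Univalent

variable {φ : ℂ → ℂ}

theorem classSb_hasDerivAt (hφ : φ ∈ classSb) : ∀ z ∈ ball (0 : ℂ) 1,
    HasDerivAt φ (deriv φ z) z := fun _ hz =>
  (hφ.1.1.differentiableAt (isOpen_ball.mem_nhds hz)).hasDerivAt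

theorem classSb_isOpen_image (hφ : φ ∈ classSb) : IsOpen (φ '' ball 0 1) :=
  isOpen_image_of_injOn isOpen_ball hφ.1.1 hφ.1.2.1 isOpen_ball subset_rfl

theorem lintegral_deriv_sq_lt_top (hφ : φ ∈ classSb) :
    ∫⁻ z in ball (0 : ℂ) 1, ENNReal.ofReal (‖deriv φ z‖ ^ 2) < ⊤ := by
  have := lintegral_image_of_hasDerivAt measurableSet_ball (classSb_hasDerivAt hφ) hφ.1.2.1
    (fun _ => 1)
  simp only [mul_one, lintegral_one, Measure.restrict_apply_univ] at this
  rw [← this]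
  exact hφ.2.measure_lt_top

theorem integrableOn_deriv (hφ : φ ∈ classSb) : IntegrableOn (deriv φ) (ball 0 1) := by
  have hc : ContinuousOn (deriv φ) (ball 0 1) := (hφ.1.1.deriv isOpen_ball).continuousOn
  have h2 : IntegrableOn (fun z => ‖deriv φ z‖ ^ 2) (ball 0 1) :=
    (lintegral_ofReal_ne_top_iff_integrable
      ((hc.norm.pow 2).aestronglyMeasurable measurableSet_ball)
      (Filter.Eventually.of_forall fun z => sq_nonneg _)).1 (lintegral_deriv_sq_lt_top hφ).ne
  have h1 : IntegrableOn (fun _ : ℂ => (1 : ℝ)) (ball 0 1) :=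
    integrableOn_const measure_ball_lt_top.ne
  refine Integrable.mono' (h1.add h2) (hc.aestronglyMeasurable measurableSet_ball)
    (Filter.Eventually.of_forall fun z => ?_)
  simp only [Pi.add_apply]
  nlinarith [sq_nonneg (‖deriv φ z‖ - 1)]

theorem one_sub_mul_conj_ne_zero {a z : ℂ} (ha : ‖a‖ < 1) (hz : ‖z‖ < 1) :
    1 - ‖a‖ ≤ ‖1 - a * starRingEnd ℂ z‖ ∧ 1 - ‖z‖ ≤ ‖1 - a * starRingEnd ℂ z‖ ∧
      1 - a * starRingEnd ℂ z ≠ 0 := by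
  have h1 : 1 - ‖a‖ * ‖z‖ ≤ ‖1 - a * starRingEnd ℂ z‖ := by
    have := norm_sub_norm_le (1 : ℂ) (a * starRingEnd ℂ z)
    rwa [norm_one, norm_mul, Complex.norm_conj] at this
  have h2 : 1 - ‖a‖ ≤ 1 - ‖a‖ * ‖z‖ := by nlinarith [norm_nonneg a]
  have h3 : 1 - ‖z‖ ≤ 1 - ‖a‖ * ‖z‖ := by nlinarith [norm_nonneg z]
  refine ⟨h2.trans h1, h3.trans h1, fun h => ?_⟩
  rw [h, norm_zero] at h1
  linarith

theorem continuousOn_bergman {a : ℂ} (ha : ‖a‖ < 1) :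
    ContinuousOn (fun z => a / (1 - a * starRingEnd ℂ z)) (ball 0 1) := by
  refine ContinuousOn.div continuousOn_const ?_ fun z hz =>
    (one_sub_mul_conj_ne_zero ha (mem_ball_zero_iff.1 hz)).2.2
  have := Complex.continuous_conj.continuousOn (s := ball 0 1)
  fun_prop

theorem IntegrableOn.bergman_mul {a : ℂ} (ha : ‖a‖ < 1) {g : ℂ → ℂ}
    (hg : IntegrableOn g (ball 0 1)) :
    IntegrableOn (fun z => a / (1 - a * starRingEnd ℂ z) * g z) (ball 0 1) := by
  refine Integrable.bdd_mul (c := (1 - ‖a‖)⁻¹) hg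
    ((continuousOn_bergman ha).aestronglyMeasurable measurableSet_ball) ?_
  refine (ae_restrict_iff' measurableSet_ball).2 (Filter.Eventually.of_forall fun z hz => ?_)
  have h := (one_sub_mul_conj_ne_zero ha (mem_ball_zero_iff.1 hz)).1
  rw [norm_div, inv_eq_one_div]
  have h0 : 0 < 1 - ‖a‖ := by linarith
  gcongr

/-- The integral representation of the logarithm of the difference quotient of `φ`. -/
theorem integral_bergman_logDeriv (hφ : φ ∈ classSb) {a : ℂ} (ha : ‖a‖ < 1) {ρ : ℝ} (hρ : 0 < ρ)
    (hsub : closedBall (φ a) ρ ⊆ φ '' ball 0 1) {Γ : ℂ → ℂ}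
    (hΓ0 : DifferentiableOn ℂ Γ (ball 0 1))
    (hΓ : ∀ z ∈ ball (0 : ℂ) 1, z ≠ a → deriv Γ z = deriv φ z / (φ z - φ a) - (z - a)⁻¹) :
    ∫ z in ball (0 : ℂ) 1 ∩ {z | ρ ≤ ‖φ z - φ a‖},
      a / (1 - a * starRingEnd ℂ z) * (deriv φ z / (φ z - φ a)) =
      Real.pi * (Γ a - Γ 0 + Real.log (1 - ‖a‖ ^ 2)) := by
  have haD : a ∈ ball (0 : ℂ) 1 := mem_ball_zero_iff.2 ha
  set g := Function.invFunOn φ (ball 0 1) with hgdef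
  have hder := classSb_hasDerivAt hφ
  have hleft := hφ.1.2.1.leftInvOn_invFunOn
  have hgD : ∀ w ∈ φ '' ball 0 1, HasDerivAt g (deriv φ (g w))⁻¹ w ∧ g w ∈ ball (0 : ℂ) 1 ∧
      φ (g w) = w := by
    rintro _ ⟨z, hz, rfl⟩
    rw [hgdef, hleft hz]
    exact ⟨hasDerivAt_invFunOn isOpen_ball hφ.1.1 hφ.1.2.1 hz, hz, rfl⟩
  have hΓ'c : ContinuousOn (deriv Γ) (ball 0 1) := (hΓ0.deriv isOpen_ball).continuousOn
  have hpole := integrableOn_inv_sub a 0 1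
  -- Γ' is bounded on the compact preimage of the closed disc. Outside it, Γ' is dominated by |φ'|/ρ
  -- plus the pole, both integrable.
  obtain ⟨M, hM⟩ : ∃ M, ∀ z ∈ ball (0 : ℂ) 1, ‖φ z - φ a‖ ≤ ρ → ‖deriv Γ z‖ ≤ M := by
    have hgc : ContinuousOn g (closedBall (φ a) ρ) := fun w hw =>
      (hgD w (hsub hw)).1.continuousAt.continuousWithinAt
    have hcomp : IsCompact (g '' closedBall (φ a) ρ) := (isCompact_closedBall _ _).image_of_continuousOn hgc
    have hsubD : g '' closedBall (φ a) ρ ⊆ ball 0 1 := by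
      rintro _ ⟨w, hw, rfl⟩
      exact (hgD w (hsub hw)).2.1
    obtain ⟨M, hM⟩ := hcomp.exists_bound_of_continuousOn (hΓ'c.mono hsubD)
    refine ⟨M, fun z hz hzρ => hM z ⟨φ z, ?_, hleft hz⟩⟩
    rwa [mem_closedBall, dist_eq_norm]
  have hΓint : IntegrableOn (deriv Γ) (ball 0 1) := by
    have h1 : IntegrableOn (fun _ : ℂ => |M|) (ball 0 1) :=
      integrableOn_const measure_ball_lt_top.ne
    refine Integrable.mono' ((h1.add ((integrableOn_deriv hφ).norm.div_const ρ)).add hpole.norm)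
      (hΓ'c.aestronglyMeasurable measurableSet_ball) ?_
    refine (ae_restrict_iff' measurableSet_ball).2 (Filter.Eventually.of_forall fun z hz => ?_)
    simp only [Pi.add_apply]
    have e1 : 0 ≤ ‖deriv φ z‖ / ρ := by positivity
    have e2 := norm_nonneg (z - a)⁻¹
    rcases le_or_gt ‖φ z - φ a‖ ρ with h | h
    · linarith [hM z hz h, le_abs_self M]
    · have hza : z ≠ a := by
        rintro rfl
        rw [sub_self, norm_zero] at h
        linarith
      rw [hΓ z hz hza]
      refine (norm_sub_le _ _).trans ?_
      rw [norm_div]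
      have : ‖deriv φ z‖ / ‖φ z - φ a‖ ≤ ‖deriv φ z‖ / ρ := by gcongr
      linarith [abs_nonneg M]
  have hI1 := IntegrableOn.bergman_mul ha hΓint
  have hI2 := IntegrableOn.bergman_mul ha hpole
  have hsum : EqOn (fun z => a / (1 - a * starRingEnd ℂ z) * deriv Γ z +
      a / (1 - a * starRingEnd ℂ z) * (z - a)⁻¹)
      (fun z => a / (1 - a * starRingEnd ℂ z) * (deriv φ z / (φ z - φ a))) (ball 0 1 \ {a}) := by
    intro z hz
    simp only
    rw [hΓ z hz.1 hz.2]
    ring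
  have hae : (ball (0 : ℂ) 1 \ {a} : Set ℂ) =ᵐ[volume] ball (0 : ℂ) 1 :=
    sdiff_null_ae_eq_self (by simp)
  have hmeas : MeasurableSet (ball (0 : ℂ) 1 \ {a}) :=
    measurableSet_ball.diff (measurableSet_singleton a)
  have hvint : IntegrableOn
      (fun z => a / (1 - a * starRingEnd ℂ z) * (deriv φ z / (φ z - φ a))) (ball 0 1) := by
    rw [← integrableOn_congr_set_ae hae]
    exact ((hI1.add hI2).mono_set sdiff_subset).congr_fun hsum hmeas
  have htot : ∫ z in ball (0 : ℂ) 1, a / (1 - a * starRingEnd ℂ z) * (deriv φ z / (φ z - φ a)) =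
      Real.pi * (Γ a - Γ 0 + Real.log (1 - ‖a‖ ^ 2)) := by
    rw [← setIntegral_congr_set hae, ← setIntegral_congr_fun hmeas hsum, setIntegral_congr_set hae,
      integral_add hI1 hI2, integral_bergman_mul_pole ha hI2,
      integral_bergman_mul ha (hΓ0.deriv isOpen_ball) (fun z hz =>
        (hΓ0.differentiableAt (isOpen_ball.mem_nhds hz)).hasDerivAt) hI1]
    ring
  have hEmeas : MeasurableSet (ball (0 : ℂ) 1 ∩ {z | ‖φ z - φ a‖ < ρ}) :=
    (((hφ.1.1.continuousOn.sub continuousOn_const).norm).isOpen_inter_preimage isOpen_ball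
      (isOpen_Iio (a := ρ))).measurableSet
  have hEimage : φ '' (ball (0 : ℂ) 1 ∩ {z | ‖φ z - φ a‖ < ρ}) = ball (φ a) ρ := by
    ext w
    constructor
    · rintro ⟨z, hz, rfl⟩
      rw [mem_ball, dist_eq_norm]
      exact hz.2
    · intro hw
      obtain ⟨z, hz, rfl⟩ := hsub (ball_subset_closedBall hw)
      rw [mem_ball, dist_eq_norm] at hw
      exact ⟨z, ⟨hz, hw⟩, rfl⟩
  have hinner : ∫ z in ball (0 : ℂ) 1 ∩ {z | ‖φ z - φ a‖ < ρ},
      a / (1 - a * starRingEnd ℂ z) * (deriv φ z / (φ z - φ a)) = 0 := by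
    -- Since φ' = |φ'|²/conj(φ'), in the variable w = φ(z) the integrand becomes the conjugate of
    -- this holomorphic function divided by w - φ(a).
    have hh : DifferentiableOn ℂ (fun w => starRingEnd ℂ a / (1 - starRingEnd ℂ a * g w) *
        (deriv φ (g w))⁻¹) (ball (φ a) ρ) := by
      intro w hw
      obtain ⟨h1, h2, -⟩ := hgD w (hsub (ball_subset_closedBall hw))
      have h3 : DifferentiableAt ℂ (fun w => deriv φ (g w)) w :=
        ((hφ.1.1.deriv isOpen_ball).differentiableAt (isOpen_ball.mem_nhds h2)).comp w
          h1.differentiableAt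
      have h4 := deriv_ne_zero_of_injOn isOpen_ball hφ.1.1 hφ.1.2.1 h2
      have h5 : 1 - starRingEnd ℂ a * g w ≠ 0 := by
        have := (one_sub_mul_conj_ne_zero (a := starRingEnd ℂ a) (z := starRingEnd ℂ (g w))
          (by rwa [Complex.norm_conj]) (by rw [Complex.norm_conj]; exact mem_ball_zero_iff.1 h2)).2.2
        rwa [Complex.conj_conj] at this
      have h6 : DifferentiableAt ℂ (fun w => 1 - starRingEnd ℂ a * g w) w :=
        (h1.differentiableAt.const_mul _).const_sub 1
      exact (((differentiableAt_const _).div h6 h5).mul (h3.inv h4)).differentiableWithinAt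
    have h0 := integral_conj_div_sub_eq_zero hh
    rw [← hEimage, integral_image_of_hasDerivAt hEmeas (fun z hz => hder z hz.1)
      (hφ.1.2.1.mono inter_subset_left)] at h0
    refine Eq.trans (setIntegral_congr_fun hEmeas fun z hz => ?_) h0
    have h4 := deriv_ne_zero_of_injOn isOpen_ball hφ.1.1 hφ.1.2.1 hz.1
    have h7 : starRingEnd ℂ (deriv φ z) ≠ 0 := (map_ne_zero _).2 h4
    have h8 : ((‖deriv φ z‖ ^ 2 : ℝ) : ℂ) = deriv φ z * starRingEnd ℂ (deriv φ z) := by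
      rw [Complex.mul_conj, Complex.normSq_eq_norm_sq]
    simp only [hgdef, hleft hz.1, map_mul, map_div₀, map_sub, map_one, Complex.conj_conj,
      map_inv₀, Complex.real_smul, h8]
    field_simp
  have hsplit := integral_inter_add_sdiff₀ (s := ball (0 : ℂ) 1)
    (t := ball (0 : ℂ) 1 ∩ {z | ‖φ z - φ a‖ < ρ}) (μ := volume)
    hEmeas.nullMeasurableSet hvint
  rw [← inter_assoc, inter_self, hinner, zero_add, htot] at hsplit
  rw [← hsplit]
  congr 2
  ext z
  simp only [mem_inter_iff, mem_ofPred_eq, Set.mem_sdiff, not_and, not_lt]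
  tauto

end Univalent

/-! ### Branches of the logarithm and difference quotients. -/

/-- Continuous logarithms of the same function on a preconnected set differ by a constant. -/
theorem eqOn_of_exp_eq {X : Type*} [TopologicalSpace X] {S : Set X} (hS : IsPreconnected S)
    {u v : X → ℂ} (hu : ContinuousOn u S) (hv : ContinuousOn v S)
    (h : ∀ x ∈ S, Complex.exp (u x) = Complex.exp (v x)) {x₀ : X} (hx₀ : x₀ ∈ S)
    (h0 : u x₀ = v x₀) {x : X} (hx : x ∈ S) : u x = v x := by
  have hint : ∀ y ∈ S, ∃ n : ℤ, u y = v y + n * (2 * Real.pi * Complex.I) := fun y hy =>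
    Complex.exp_eq_exp_iff_exists_int.1 (h y hy)
  have hpi : (2 * Real.pi * Complex.I : ℂ) ≠ 0 := Complex.two_pi_I_ne_zero
  have hquot : ∀ y, ∀ n : ℤ, u y = v y + n * (2 * Real.pi * Complex.I) →
      (u y - v y) / (2 * Real.pi * Complex.I) = n := fun y n hn => by
    rw [hn, add_sub_cancel_left, mul_div_cancel_right₀ _ hpi]
  have hmaps : MapsTo (fun y => ((u y - v y) / (2 * Real.pi * Complex.I)).re) S
      (((↑) : ℤ → ℝ) '' univ) := by
    intro y hy
    obtain ⟨n, hn⟩ := hint y hy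
    refine ⟨n, mem_univ _, ?_⟩
    simp only [hquot y n hn, Complex.intCast_re]
  have hcont : ContinuousOn (fun y => ((u y - v y) / (2 * Real.pi * Complex.I)).re) S :=
    Complex.continuous_re.comp_continuousOn ((hu.sub hv).div_const _)
  have hdisc : IsDiscrete (((↑) : ℤ → ℝ) '' univ) :=
    IsDiscrete.univ.image Int.isClosedEmbedding_coe_real.isInducing
  have hc := hS.constant_of_mapsTo hdisc hcont hmaps hx hx₀
  obtain ⟨n, hn⟩ := hint x hx
  simp only [h0, sub_self, zero_div, hquot x n hn, Complex.intCast_re, Complex.zero_re,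
    Int.cast_eq_zero] at hc
  rw [hn, hc]
  simp

open Filter Topology in
/-- The difference quotient of a holomorphic function is jointly continuous. -/
theorem continuousOn_dslope_prod {f : ℂ → ℂ} {U : Set ℂ} (hU : IsOpen U)
    (hf : DifferentiableOn ℂ f U) :
    ContinuousOn (fun p : ℂ × ℂ => dslope f p.1 p.2) (U ×ˢ U) := by
  rintro ⟨x, y⟩ ⟨hx, hy⟩
  apply ContinuousAt.continuousWithinAt
  have hfc : ∀ z ∈ U, ContinuousAt f z := fun z hz => hf.continuousOn.continuousAt (hU.mem_nhds hz)
  by_cases hxy : x = y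
  -- On the diagonal, joint continuity is strict differentiability together with continuity of the
  -- derivative.
  · subst hxy
    have hstrict : HasStrictDerivAt f (deriv f x) x :=
      (hf.analyticAt (hU.mem_nhds hx)).hasStrictDerivAt
    have hd : ContinuousAt (deriv f) x :=
      (hf.deriv hU).continuousOn.continuousAt (hU.mem_nhds hx)
    rw [hasStrictDerivAt_iff_hasStrictFDerivAt] at hstrict
    rw [ContinuousAt, Metric.tendsto_nhds]
    intro η hη
    have h1 := hstrict.isLittleO.def (half_pos hη)
    have h2 : ∀ᶠ p : ℂ × ℂ in 𝓝 (x, x), dist (deriv f p.1) (deriv f x) < η :=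
      (hd.comp (f := Prod.fst) (x := (x, x)) continuousAt_fst).eventually
        (Metric.ball_mem_nhds _ hη)
    filter_upwards [h1, h2] with p hp1 hp2
    simp only [dslope_same]
    by_cases hp : p.2 = p.1
    · rw [hp, dslope_same]
      exact hp2
    · rw [dslope_of_ne _ hp, dist_eq_norm, slope_def_field]
      have hne : p.2 - p.1 ≠ 0 := sub_ne_zero.2 hp
      have h3 : (f p.2 - f p.1) / (p.2 - p.1) - deriv f x =
          -(f p.1 - f p.2 - (p.1 - p.2) * deriv f x) / (p.2 - p.1) := by
        field_simp
        ring
      rw [h3, norm_div, norm_neg, div_lt_iff₀ (norm_pos_iff.2 hne)]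
      have h4 : ‖f p.1 - f p.2 - (p.1 - p.2) * deriv f x‖ ≤ η / 2 * ‖p.1 - p.2‖ := by
        simpa using hp1
      rw [norm_sub_rev p.1] at h4
      have := norm_pos_iff.2 hne
      nlinarith
  · have hev : (fun p : ℂ × ℂ => dslope f p.1 p.2) =ᶠ[𝓝 (x, y)]
        fun p => (f p.2 - f p.1) / (p.2 - p.1) := by
      have : {p : ℂ × ℂ | p.1 ≠ p.2} ∈ 𝓝 (x, y) :=
        (isOpen_ne_fun continuous_fst continuous_snd).mem_nhds hxy
      filter_upwards [this] with p hp
      rw [dslope_of_ne _ (Ne.symm hp), slope_def_field]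
    refine ContinuousAt.congr ?_ hev.symm
    have e1 : ContinuousAt (fun p : ℂ × ℂ => f p.1) (x, y) :=
      (hfc x hx).comp (f := Prod.fst) (x := (x, y)) continuousAt_fst
    have e2 : ContinuousAt (fun p : ℂ × ℂ => f p.2) (x, y) :=
      (hfc y hy).comp (f := Prod.snd) (x := (x, y)) continuousAt_snd
    exact (e2.sub e1).div (by fun_prop) (sub_ne_zero.2 (Ne.symm hxy))

theorem dslope_ne_zero_of_injOn {f : ℂ → ℂ} {U : Set ℂ} (hU : IsOpen U)
    (hf : DifferentiableOn ℂ f U) (hi : InjOn f U) {x y : ℂ} (hx : x ∈ U) (hy : y ∈ U) :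
    dslope f x y ≠ 0 := by
  by_cases hxy : y = x
  · rw [hxy, dslope_same]
    exact deriv_ne_zero_of_injOn hU hf hi hx
  · rw [dslope_of_ne _ hxy, slope_def_field]
    exact div_ne_zero (sub_ne_zero.2 fun h => hxy (hi hy hx h)) (sub_ne_zero.2 hxy)

theorem Convex.isSimplyConnected' {E : Type*} [AddCommGroup E] [Module ℝ E] [TopologicalSpace E]
    [IsTopologicalAddGroup E] [ContinuousSMul ℝ E] {s : Set E} (hs : Convex ℝ s)
    (hne : s.Nonempty) : IsSimplyConnected s := by
  have := hs.contractibleSpace hne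
  exact inferInstanceAs (SimplyConnectedSpace s)

section Branch

variable {φ : ℂ → ℂ}

theorem exists_isLogBranch (hφ : φ ∈ classSb) : ∃ L, IsLogBranch φ L := by
  obtain ⟨⟨hd, hi, h0, h1⟩, -⟩ := hφ
  have hz0 : (0 : ℂ) ∈ ball (0 : ℂ) 1 := mem_ball_self one_pos
  have hds : DifferentiableOn ℂ (dslope φ 0) (ball 0 1) :=
    (Complex.differentiableOn_dslope (ball_mem_nhds _ one_pos)).2 hd
  obtain ⟨L, hL, -, hLe⟩ := exists_differentiableOn_log one_pos (y := 0)
    ((hd.deriv isOpen_ball).div hds fun z hz => dslope_ne_zero_of_injOn isOpen_ball hd hi hz0 hz)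
    (fun z hz => div_ne_zero (deriv_ne_zero_of_injOn isOpen_ball hd hi hz)
      (dslope_ne_zero_of_injOn isOpen_ball hd hi hz0 hz)) (by simp [h1])
  refine ⟨L, hL, fun z hz hz' => ?_⟩
  rw [hLe z hz, Pi.div_apply, dslope_of_ne _ hz', slope_def_field, h0, sub_zero, sub_zero]
  field_simp

open Filter Topology in
theorem IsLogBranch.exp_eq (hφ : φ ∈ classSb) {L : ℂ → ℂ} (hL : IsLogBranch φ L) {z : ℂ}
    (hz : z ∈ ball (0 : ℂ) 1) : Complex.exp (L z) = deriv φ z / dslope φ 0 z := by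
  obtain ⟨⟨hd, hi, h0, h1⟩, -⟩ := hφ
  have hz0 : (0 : ℂ) ∈ ball (0 : ℂ) 1 := mem_ball_self one_pos
  have hne : ∀ w ∈ ball (0 : ℂ) 1, w ≠ 0 → Complex.exp (L w) = deriv φ w / dslope φ 0 w := by
    intro w hw hw0
    rw [hL.2 w hw hw0, dslope_of_ne _ hw0, slope_def_field, h0, sub_zero, sub_zero]
    field_simp
  by_cases hz' : z = 0
  · subst hz'
    have hnhds := isOpen_ball.mem_nhds hz
    have hds : ContinuousAt (dslope φ 0) 0 :=
      ((Complex.differentiableOn_dslope hnhds).2 hd).continuousOn.continuousAt hnhds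
    have c1 : ContinuousAt (fun w => Complex.exp (L w)) 0 :=
      (hL.1.continuousOn.continuousAt hnhds).cexp
    have c2 : ContinuousAt (fun w => deriv φ w / dslope φ 0 w) 0 :=
      ((hd.deriv isOpen_ball).continuousOn.continuousAt hnhds).div hds
        (dslope_ne_zero_of_injOn isOpen_ball hd hi hz0 hz0)
    refine tendsto_nhds_unique (l := 𝓝[≠] (0 : ℂ)) (c1.tendsto.mono_left nhdsWithin_le_nhds)
      ((c2.tendsto.mono_left nhdsWithin_le_nhds).congr' ?_)
    filter_upwards [self_mem_nhdsWithin, nhdsWithin_le_nhds hnhds] with w hw hw'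
    exact (hne w hw' hw).symm
  · exact hne z hz hz'

/-- A branch of `log (z φ' / φ)` is the increment from `0` to `a` of a holomorphic logarithm of the
difference quotient of `φ` at `a`. -/
theorem IsLogBranch.exists_log_dslope (hφ : φ ∈ classSb) {L : ℂ → ℂ} (hL : IsLogBranch φ L)
    {a : ℂ} (ha : a ∈ ball (0 : ℂ) 1) :
    ∃ Γ : ℂ → ℂ, DifferentiableOn ℂ Γ (ball 0 1) ∧
      (∀ z ∈ ball (0 : ℂ) 1, z ≠ a →
        deriv Γ z = deriv φ z / (φ z - φ a) - (z - a)⁻¹) ∧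
      Γ a - Γ 0 = L a - L 0 := by
  have hLe := fun z hz => hL.exp_eq hφ (z := z) hz
  obtain ⟨⟨hd, hi, h0, h1⟩, -⟩ := hφ
  have hz0 : (0 : ℂ) ∈ ball (0 : ℂ) 1 := mem_ball_self one_pos
  have hne : ∀ x ∈ ball (0 : ℂ) 1, ∀ y ∈ ball (0 : ℂ) 1, dslope φ x y ≠ 0 := fun x hx y hy =>
    dslope_ne_zero_of_injOn isOpen_ball hd hi hx hy
  -- One logarithm of the difference quotient on the whole bidisc links the branches for different
  -- a: its values at (a, a) and (a, 0) are logarithms of φ'(a) and φ(a)/a, which are compared with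
  -- L along the disc.
  obtain ⟨Λ, hΛc, hΛ⟩ := Complex.exists_continuousOn_eqOn_exp_comp
    (U := ball (0 : ℂ) 1 ×ˢ ball (0 : ℂ) 1)
    (((convex_ball _ _).prod (convex_ball _ _)).isSimplyConnected' ⟨(0, 0), hz0, hz0⟩)
    (isOpen_ball.prod isOpen_ball) (continuousOn_dslope_prod isOpen_ball hd)
    (by
      rintro ⟨p, hp, hp0⟩
      exact hne _ hp.1 _ hp.2 hp0)
  have hΛe : ∀ x ∈ ball (0 : ℂ) 1, ∀ y ∈ ball (0 : ℂ) 1,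
      Complex.exp (Λ (x, y)) = dslope φ x y := fun x hx y hy => hΛ ⟨hx, hy⟩
  have hpre : IsPreconnected (ball (0 : ℂ) 1) := (convex_ball _ _).isPreconnected
  have hdiag : L a - L 0 = Λ (a, a) - Λ (a, 0) := by
    refine eqOn_of_exp_eq hpre (u := fun z => L z - L 0) (v := fun z => Λ (z, z) - Λ (z, 0))
      (hL.1.continuousOn.sub continuousOn_const) ?_ ?_ hz0 (by simp) ha
    · exact (hΛc.comp (f := fun z => (z, z)) (by fun_prop) fun z hz => ⟨hz, hz⟩).sub
        (hΛc.comp (f := fun z => (z, 0)) (by fun_prop) fun z hz => ⟨hz, hz0⟩)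
    · intro z hz
      have hsymm : dslope φ z 0 = dslope φ 0 z := by
        by_cases h : z = 0
        · rw [h]
        · rw [dslope_of_ne _ h, dslope_of_ne _ (Ne.symm h), slope_comm]
      rw [Complex.exp_sub, Complex.exp_sub, hLe z hz, hLe 0 hz0, hΛe z hz z hz, hΛe z hz 0 hz0,
        dslope_same, dslope_same, h1, div_one, div_one, hsymm]
  have hds : DifferentiableOn ℂ (dslope φ a) (ball 0 1) :=
    (Complex.differentiableOn_dslope (isOpen_ball.mem_nhds ha)).2 hd
  obtain ⟨Γ, hΓ, hΓ0, hΓe⟩ := exists_differentiableOn_log one_pos hds (hne a ha) (hΛe a ha 0 hz0)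
  have hΓΛ : ∀ z ∈ ball (0 : ℂ) 1, Γ z = Λ (a, z) := fun z hz =>
    eqOn_of_exp_eq hpre (v := fun z => Λ (a, z)) hΓ.continuousOn
      (hΛc.comp (f := fun z => (a, z)) (by fun_prop) fun z hz => ⟨ha, hz⟩)
      (fun z hz => by rw [hΓe z hz, hΛe a ha z hz]) hz0 hΓ0 hz
  refine ⟨Γ, hΓ, fun z hz hza => ?_, by rw [hdiag, hΓΛ a ha, hΓΛ 0 hz0]⟩
  have hnhds := isOpen_ball.mem_nhds hz
  have hza' : z - a ≠ 0 := sub_ne_zero.2 hza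
  have hφza : φ z - φ a ≠ 0 := sub_ne_zero.2 fun h => hza (hi hz ha h)
  have e1 := (hΓ.differentiableAt hnhds).hasDerivAt.cexp
  have e2 : HasDerivAt (fun w => (φ w - φ a) / (w - a))
      ((deriv φ z * (z - a) - (φ z - φ a) * 1) / (z - a) ^ 2) z :=
    ((hd.differentiableAt hnhds).hasDerivAt.sub_const _).fun_div
      ((hasDerivAt_id z).sub_const a) hza'
  have e3 := e2.congr_of_eventuallyEq (f₁ := fun w => Complex.exp (Γ w)) (by
    filter_upwards [hnhds, isOpen_ne.mem_nhds hza] with w hw hwa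
    rw [hΓe w hw, dslope_of_ne _ hwa, slope_def_field])
  have e4 := e1.unique e3
  rw [hΓe z hz, dslope_of_ne _ hza, slope_def_field] at e4
  field_simp at e4 ⊢
  linear_combination e4

end Branch

/-! ### Distance to the boundary of the image. -/

section Distortion

variable {φ : ℂ → ℂ}

theorem classSb_compl_nonempty (hφ : φ ∈ classSb) : ((φ '' ball 0 1)ᶜ).Nonempty := by
  rw [nonempty_compl]
  intro h
  exact NormedSpace.unbounded_univ ℝ ℂ (h ▸ hφ.2)

theorem classSb_infDist_pos (hφ : φ ∈ classSb) {w : ℂ} (hw : w ∈ φ '' ball 0 1) :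
    0 < infDist w (φ '' ball 0 1)ᶜ := by
  rw [← (classSb_isOpen_image hφ).isClosed_compl.notMem_iff_infDist_pos
    (classSb_compl_nonempty hφ)]
  simpa using hw

theorem norm_deriv_mul_le_infDist (hφ : φ ∈ classSb) {z : ℂ} (hz : z ∈ ball (0 : ℂ) 1) :
    ‖deriv φ z‖ * (1 - ‖z‖) ≤ 32 * infDist (φ z) (φ '' ball 0 1)ᶜ := by
  have hz1 : 0 < 1 - ‖z‖ := by
    rw [mem_ball_zero_iff] at hz
    linarith
  have hsub : ball z (1 - ‖z‖) ⊆ ball 0 1 := by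
    apply ball_subset_ball'
    rw [dist_zero_right]
    linarith
  obtain ⟨M, hM⟩ := hφ.2.exists_norm_le
  have hk := koebe_ball_subset hz1 (hφ.1.1.mono hsub) (hφ.1.2.1.mono hsub)
    (M := M) fun w hw => hM _ (mem_image_of_mem φ (hsub hw))
  have : (1 - ‖z‖) * ‖deriv φ z‖ / 32 ≤ infDist (φ z) (φ '' ball 0 1)ᶜ := by
    rw [le_infDist (classSb_compl_nonempty hφ)]
    intro y hy
    by_contra! hcon
    rw [dist_comm] at hcon
    exact hy (image_mono hsub (hk hcon))
  linarith

/-- For each omitted value b, the Koebe estimate bounds the derivative of log(φ - b) by 32/(1-|z|);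
integrate along the segment from 0 to a. Only the logarithm of this bound is used, so the exponent
32 is harmless. -/
theorem infDist_lower_bound (hφ : φ ∈ classSb) {a : ℂ} (ha : a ∈ ball (0 : ℂ) 1) :
    infDist 0 (φ '' ball 0 1)ᶜ * (1 - ‖a‖) ^ 32 ≤ infDist (φ a) (φ '' ball 0 1)ᶜ := by
  rw [mem_ball_zero_iff] at ha
  have ha1 : 0 < 1 - ‖a‖ := by linarith
  rw [le_infDist (classSb_compl_nonempty hφ)]
  intro b hb
  have hz0 : (0 : ℂ) ∈ ball (0 : ℂ) 1 := mem_ball_self one_pos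
  have hne : ∀ z ∈ ball (0 : ℂ) 1, φ z - b ≠ 0 := fun z hz h =>
    hb ⟨z, hz, sub_eq_zero.1 h⟩
  obtain ⟨l, hl, -, hle⟩ := exists_differentiableOn_log one_pos (hφ.1.1.sub_const b) hne
    (Complex.exp_log (hne 0 hz0))
  have hl' : ∀ z ∈ ball (0 : ℂ) 1, ‖deriv l z‖ ≤ 32 / (1 - ‖z‖) := by
    intro z hz
    have hnhds := isOpen_ball.mem_nhds hz
    have e1 := (hl.differentiableAt hnhds).hasDerivAt.cexp
    have e2 := ((hφ.1.1.differentiableAt hnhds).hasDerivAt.sub_const b).congr_of_eventuallyEq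
      (f₁ := fun w => Complex.exp (l w)) (by filter_upwards [hnhds] with w hw using hle w hw)
    have e3 := e1.unique e2
    rw [hle z hz] at e3
    have e4 := norm_deriv_mul_le_infDist hφ hz
    have e5 : infDist (φ z) (φ '' ball 0 1)ᶜ ≤ ‖φ z - b‖ := by
      rw [← dist_eq_norm]
      exact infDist_le_dist_of_mem hb
    have e6 := norm_pos_iff.2 (hne z hz)
    rw [mem_ball_zero_iff] at hz
    have hz1 : 0 < 1 - ‖z‖ := by linarith
    rw [← e3, norm_mul] at e4
    rw [le_div_iff₀ hz1]
    nlinarith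
  have hseg : ∀ t ∈ Icc (0 : ℝ) 1, (t * a : ℂ) ∈ ball (0 : ℂ) 1 ∧ ‖(t * a : ℂ)‖ = t * ‖a‖ ∧
      0 < 1 - t * ‖a‖ := by
    intro t ht
    have h1 : ‖(t * a : ℂ)‖ = t * ‖a‖ := by
      rw [norm_mul, Complex.norm_real, Real.norm_eq_abs, abs_of_nonneg ht.1]
    have h2 : t * ‖a‖ < 1 := by nlinarith [norm_nonneg a, ht.1, ht.2]
    exact ⟨by rw [mem_ball_zero_iff, h1]; exact h2, h1, by linarith⟩
  have hder : ∀ t ∈ Icc (0 : ℝ) 1,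
      HasDerivAt (fun t : ℝ => l (t * a) - l 0) (deriv l (t * a) * a) t := by
    intro t ht
    have e1 : HasDerivAt (fun t : ℝ => (t * a : ℂ)) a t := by
      simpa using ((hasDerivAt_id (t : ℂ)).comp_ofReal).mul_const a
    exact ((hl.differentiableAt (isOpen_ball.mem_nhds (hseg t ht).1)).hasDerivAt.comp t e1).sub_const _
  have hB : ∀ t ∈ Icc (0 : ℝ) 1, HasDerivAt (fun t : ℝ => -(32 * Real.log (1 - t * ‖a‖)))
      (32 * ‖a‖ / (1 - t * ‖a‖)) t := by
    intro t ht
    have e1 : HasDerivAt (fun t : ℝ => 1 - t * ‖a‖) (-‖a‖) t := by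
      simpa using ((hasDerivAt_id t).mul_const ‖a‖).const_sub 1
    refine (((e1.log (hseg t ht).2.2.ne').const_mul 32).neg).congr_deriv ?_
    ring
  have hbound := image_norm_le_of_norm_deriv_right_le_deriv_boundary'
    (f := fun t : ℝ => l (t * a) - l 0) (f' := fun t : ℝ => deriv l (t * a) * a)
    (B := fun t : ℝ => -(32 * Real.log (1 - t * ‖a‖)))
    (B' := fun t : ℝ => 32 * ‖a‖ / (1 - t * ‖a‖)) (a := 0) (b := 1)
    (fun t ht => (hder t ht).continuousAt.continuousWithinAt)
    (fun t ht => (hder t (Ico_subset_Icc_self ht)).hasDerivWithinAt) (by simp)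
    (fun t ht => (hB t ht).continuousAt.continuousWithinAt)
    (fun t ht => (hB t (Ico_subset_Icc_self ht)).hasDerivWithinAt)
    (fun t ht => by
      obtain ⟨h1, h2, h3⟩ := hseg t (Ico_subset_Icc_self ht)
      have := hl' _ h1
      rw [h2] at this
      rw [norm_mul, mul_div_right_comm]
      gcongr) (right_mem_Icc.2 zero_le_one)
  simp only [Complex.ofReal_one, one_mul] at hbound
  have haD : a ∈ ball (0 : ℂ) 1 := by rwa [mem_ball_zero_iff]
  have hre : (l 0).re + 32 * Real.log (1 - ‖a‖) ≤ (l a).re := by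
    have := (abs_le.1 ((Complex.abs_re_le_norm _).trans hbound)).1
    rw [Complex.sub_re] at this
    linarith
  have h1 : ‖φ a - b‖ = Real.exp (l a).re := by rw [← hle a haD, Complex.norm_exp]
  have h2 : ‖φ 0 - b‖ = Real.exp (l 0).re := by rw [← hle 0 hz0, Complex.norm_exp]
  have h3 : infDist 0 (φ '' ball 0 1)ᶜ ≤ ‖φ 0 - b‖ := by
    rw [hφ.1.2.2.1, ← dist_eq_norm]
    exact infDist_le_dist_of_mem hb
  have h4 : Real.exp (32 * Real.log (1 - ‖a‖)) = (1 - ‖a‖) ^ 32 := by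
    rw [show (32 : ℝ) = ((32 : ℕ) : ℝ) by norm_num, ← Real.log_pow, Real.exp_log (by positivity)]
  rw [dist_eq_norm, h1]
  calc _ ≤ Real.exp (l 0).re * Real.exp (32 * Real.log (1 - ‖a‖)) := by
        rw [h4, ← h2]; gcongr
    _ ≤ _ := by rw [← Real.exp_add]; exact Real.exp_le_exp.2 hre

end Distortion

/-! ### Mass of the kernel weight and energy of annuli. -/

theorem lintegral_ofReal_deriv_le {F f : ℝ → ℝ} {a b : ℝ} (hab : a ≤ b)
    (hc : ContinuousOn F (Icc a b)) (hd : ∀ x ∈ Ioo a b, HasDerivAt F (f x) x)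
    (hf : ∀ x ∈ Ioo a b, 0 ≤ f x) :
    ∫⁻ x in Ioo a b, ENNReal.ofReal (f x) ≤ ENNReal.ofReal (F b - F a) := by
  have hint := intervalIntegral.integrableOn_deriv_of_nonneg hc hd hf
  have hii : IntervalIntegrable f volume a b := by
    rwa [intervalIntegrable_iff_integrableOn_Ioc_of_le hab]
  have h := intervalIntegral.integral_eq_sub_of_hasDerivAt_of_le hab hc hd hii
  rw [intervalIntegral.integral_of_le hab, integral_Ioc_eq_integral_Ioo] at h
  rw [← h, ofReal_integral_eq_lintegral_ofReal (hint.mono_set Ioo_subset_Ioc_self)]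
  exact (ae_restrict_iff' measurableSet_Ioo).2 (Filter.Eventually.of_forall hf)

open Real in
theorem lintegral_angular_le {x : ℝ} (hx : 0 < x) :
    ∫⁻ θ in Ioo (-π) π, ENNReal.ofReal (((x + |θ|) * √(x + |θ|))⁻¹) ≤
      ENNReal.ofReal (4 / √x) := by
  have hpi := pi_pos
  have hder : ∀ y : ℝ, 0 < y → HasDerivAt (fun y => -(2 / √y)) ((y * √y)⁻¹) y := by
    intro y hy
    have hs : 0 < √y := sqrt_pos.2 hy
    have e := (((hasDerivAt_sqrt hy.ne').inv hs.ne').const_mul 2).neg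
    refine (e.congr_deriv ?_).congr_of_eventuallyEq (Filter.Eventually.of_forall fun z => ?_)
    · rw [sq_sqrt hy.le]
      field_simp
    · simp [div_eq_mul_inv]
  have h1 : ∫⁻ θ in Ioo 0 π, ENNReal.ofReal (((x + |θ|) * √(x + |θ|))⁻¹) ≤
      ENNReal.ofReal (2 / √x) := by
    refine (setLIntegral_congr_fun measurableSet_Ioo fun θ hθ => by
      rw [abs_of_pos hθ.1]).trans_le ((lintegral_ofReal_deriv_le
        (F := fun θ => -(2 / √(x + θ))) hpi.le ?_ ?_ ?_).trans ?_)
    · exact (ContinuousOn.div continuousOn_const (by fun_prop) fun θ hθ =>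
        (sqrt_pos.2 (by linarith [hθ.1])).ne').neg
    · intro θ hθ
      exact (hder (x + θ) (by linarith [hθ.1])).comp_const_add x θ
    · intro θ hθ
      have := hθ.1
      positivity
    · refine ENNReal.ofReal_le_ofReal ?_
      have : 0 ≤ 2 / √(x + π) := by positivity
      simp only [add_zero]
      linarith
  have h2 : ∫⁻ θ in Ioo (-π) 0, ENNReal.ofReal (((x + |θ|) * √(x + |θ|))⁻¹) ≤
      ENNReal.ofReal (2 / √x) := by
    refine (setLIntegral_congr_fun measurableSet_Ioo fun θ hθ => by
      rw [abs_of_neg hθ.2, ← sub_eq_add_neg]).trans_le ((lintegral_ofReal_deriv_le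
        (F := fun θ => 2 / √(x - θ)) (by linarith) ?_ ?_ ?_).trans ?_)
    · exact (ContinuousOn.div continuousOn_const (by fun_prop) fun θ hθ =>
        (sqrt_pos.2 (by linarith [hθ.2])).ne')
    · intro θ hθ
      have := ((hder (x - θ) (by linarith [hθ.2])).comp_const_sub x θ).neg
      rw [neg_neg] at this
      exact this.congr_of_eventuallyEq (Filter.Eventually.of_forall fun z => by simp)
    · intro θ hθ
      have : 0 < x - θ := by linarith [hθ.2]
      positivity
    · refine ENNReal.ofReal_le_ofReal ?_
      have : 0 ≤ 2 / √(x - -π) := by positivity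
      simp only [sub_zero]
      linarith
  have hsub : (Ioo (-π) π : Set ℝ) =ᵐ[volume] (Ioo (-π) 0 ∪ Ioo 0 π : Set ℝ) := by
    have : (Ioo (-π) π \ {0} : Set ℝ) =ᵐ[volume] Ioo (-π) π := sdiff_null_ae_eq_self (by simp)
    refine this.symm.trans (Filter.EventuallyEq.of_eq ?_)
    ext t
    constructor
    · rintro ⟨⟨h1, h2⟩, h3⟩
      rcases lt_or_gt_of_ne h3 with h | h
      · exact Or.inl ⟨h1, h⟩
      · exact Or.inr ⟨h, h2⟩
    · rintro (⟨h1, h2⟩ | ⟨h1, h2⟩)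
      · exact ⟨⟨h1, by linarith⟩, h2.ne⟩
      · exact ⟨⟨by linarith, h2⟩, h1.ne'⟩
  rw [setLIntegral_congr hsub]
  refine (lintegral_union_le _ _ _).trans ((add_le_add h2 h1).trans ?_)
  rw [← ENNReal.ofReal_add (by positivity) (by positivity)]
  exact ENNReal.ofReal_le_ofReal (le_of_eq (by ring))

open Real in
theorem lintegral_radial_le {q : ℝ} (hq : 0 < q) (hq1 : q ≤ 1) :
    ∫⁻ r in Ioo 0 1, ENNReal.ofReal ((√(1 - r) * √(1 - r + q))⁻¹) ≤
      ENNReal.ofReal (log (1 / q) + 4) := by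
  refine (lintegral_ofReal_deriv_le (F := fun r => -(2 * log (√(1 - r) + √(1 - r + q))))
    zero_le_one ?_ ?_ ?_).trans (ENNReal.ofReal_le_ofReal ?_)
  · refine (ContinuousOn.mul continuousOn_const (ContinuousOn.log (by fun_prop) ?_)).neg
    intro r hr
    have : 0 < √(1 - r + q) := sqrt_pos.2 (by linarith [hr.2])
    positivity
  · intro r hr
    have h1 : 0 < 1 - r := by linarith [hr.2]
    have s1 : 0 < √(1 - r) := sqrt_pos.2 h1
    have s2 : 0 < √(1 - r + q) := sqrt_pos.2 (by linarith)
    have e0 : HasDerivAt (fun r : ℝ => 1 - r) (-1) r := by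
      simpa using (hasDerivAt_id r).const_sub 1
    have e1 := e0.sqrt h1.ne'
    have e2 := (e0.add_const q).sqrt (by linarith : (1 - r + q) ≠ 0)
    refine ((((e1.add e2).log (by simp only [Pi.add_apply]; positivity)).const_mul 2).neg).congr_deriv ?_
    simp only [Pi.add_apply]
    field_simp
    ring
  · intro r hr
    positivity
  · have h1 : √q * √q = q := mul_self_sqrt hq.le
    have hlogq : log √q = log q / 2 := by rw [log_sqrt hq.le]
    have h3 : √(1 + q) ≤ 2 := by
      rw [sqrt_le_left (by norm_num)]
      linarith
    have h4 : log (1 + √(1 + q)) ≤ 2 := by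
      have := log_le_sub_one_of_pos (show 0 < 1 + √(1 + q) by positivity)
      linarith
    rw [log_div one_ne_zero hq.ne', log_one]
    norm_num [hlogq]
    linarith

open Real in
theorem norm_one_sub_mul_exp_ge {ρ θ : ℝ} (h0 : 0 ≤ ρ) (_ : ρ ≤ 1) (hθ : |θ| ≤ π) :
    (1 - ρ + |θ|) / 6 ≤ ‖(1 - ρ * Complex.exp (θ * Complex.I) : ℂ)‖ := by
  have hpi := pi_pos
  have hpi4 := pi_lt_d2
  have hsq : ‖(1 - ρ * Complex.exp (θ * Complex.I) : ℂ)‖ ^ 2 =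
      (1 - ρ) ^ 2 + 4 * ρ * sin (θ / 2) ^ 2 := by
    have hcos : cos θ = 1 - 2 * sin (θ / 2) ^ 2 := by
      have := cos_two_mul (θ / 2)
      rw [mul_div_cancel₀ θ two_ne_zero] at this
      rw [this, cos_sq']
      ring
    rw [← Complex.normSq_eq_norm_sq, Complex.normSq_apply]
    simp only [Complex.sub_re, Complex.one_re, Complex.mul_re, Complex.ofReal_re,
      Complex.exp_ofReal_mul_I_re, Complex.ofReal_im, Complex.exp_ofReal_mul_I_im, zero_mul,
      sub_zero, Complex.sub_im, Complex.one_im, Complex.mul_im, add_zero, zero_sub]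
    have := sin_sq_add_cos_sq θ
    rw [hcos] at this ⊢
    linear_combination ρ ^ 2 * this
  have hsin : (|θ| / π) ^ 2 ≤ sin (θ / 2) ^ 2 := by
    rw [← sq_abs (sin _)]
    have h2 := mul_abs_le_abs_sin (x := θ / 2) (by
      rw [abs_div, abs_two]; linarith)
    rw [abs_div, abs_two] at h2
    have h3 : 2 / π * (|θ| / 2) = |θ| / π := by field_simp
    rw [h3] at h2
    gcongr
  have hθ0 := abs_nonneg θ
  refine le_of_sq_le_sq ?_ (norm_nonneg _)
  rw [hsq]
  -- For ρ ≥ 1/4 the sine term controls θ²; for smaller ρ, 1 - ρ > 3/4 alone exceeds (1 + π)/6.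
  rcases le_or_gt (1 / 4) ρ with h | h
  · have h5 : |θ| ^ 2 / 10 ≤ (|θ| / π) ^ 2 := by
      rw [div_pow]
      apply div_le_div_of_nonneg_left (sq_nonneg _) (by positivity)
      nlinarith
    have h6 : (|θ| / π) ^ 2 ≤ 4 * ρ * sin (θ / 2) ^ 2 := by nlinarith [sq_nonneg (|θ| / π)]
    nlinarith [sq_nonneg (1 - ρ - |θ|)]
  · have h5 : 0 ≤ 4 * ρ * sin (θ / 2) ^ 2 := by positivity
    nlinarith

/-- The weight appearing in the estimate of the Bergman kernel against the boundary distance. -/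
noncomputable def kernelWeight (a z : ℂ) : ℝ :=
  (‖1 - a * starRingEnd ℂ z‖ * √‖1 - a * starRingEnd ℂ z‖ * √(1 - ‖z‖))⁻¹

theorem measurable_kernelWeight (a : ℂ) : Measurable (kernelWeight a) := by
  have h : Measurable fun z : ℂ => starRingEnd ℂ z := Complex.continuous_conj.measurable
  unfold kernelWeight
  fun_prop

theorem lintegral_kernelWeight_rotate {c : ℂ} (hc : ‖c‖ = 1) (s : ℝ) :
    ∫⁻ z in ball (0 : ℂ) 1, ENNReal.ofReal (kernelWeight (s * c) z) =
      ∫⁻ z in ball (0 : ℂ) 1, ENNReal.ofReal (kernelWeight s z) := by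
  have hcc : c * starRingEnd ℂ c = 1 := by
    rw [Complex.mul_conj, Complex.normSq_eq_norm_sq, hc]
    simp
  let u : Circle := ⟨c, mem_sphere_zero_iff_norm.2 hc⟩
  have hmp := (rotation u).measurePreserving
  rw [← lintegral_indicator measurableSet_ball, ← lintegral_indicator measurableSet_ball,
    ← hmp.lintegral_comp_emb (rotation u).toHomeomorph.measurableEmbedding]
  congr with z
  have hu : rotation u z = c * z := rotation_apply u z
  have hn : ‖c * z‖ = ‖z‖ := by rw [norm_mul, hc, one_mul]
  rw [hu]
  by_cases hz : z ∈ ball (0 : ℂ) 1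
  · have hz' : c * z ∈ ball (0 : ℂ) 1 := by
      rw [mem_ball_zero_iff, hn]
      exact mem_ball_zero_iff.1 hz
    rw [indicator_of_mem hz, indicator_of_mem hz', kernelWeight, kernelWeight, hn, map_mul]
    have : (s * c * (starRingEnd ℂ c * starRingEnd ℂ z) : ℂ) = s * starRingEnd ℂ z := by
      linear_combination (s * starRingEnd ℂ z) * hcc
    rw [this]
  · have hz' : c * z ∉ ball (0 : ℂ) 1 := by
      rw [mem_ball_zero_iff, hn]
      simpa using hz
    rw [indicator_of_notMem hz, indicator_of_notMem hz']

open Real in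
theorem kernelWeight_circleMap_le {s r θ : ℝ} (hs : 0 ≤ s) (hs1 : s < 1) (hr : 0 < r)
    (hr1 : r < 1) (hθ : |θ| ≤ π) :
    kernelWeight s (circleMap 0 r θ) ≤
      15 / √(1 - r) * ((1 - s * r + |θ|) * √(1 - s * r + |θ|))⁻¹ := by
  have hsr : s * r < 1 := by nlinarith
  have hn : ‖circleMap 0 r θ‖ = r := by simp [abs_of_pos hr]
  have hconj : (s * starRingEnd ℂ (circleMap 0 r θ) : ℂ) =
      ((s * r : ℝ) : ℂ) * Complex.exp ((-θ : ℝ) * Complex.I) := by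
    rw [circleMap, zero_add, map_mul, Complex.conj_ofReal, ← Complex.exp_conj, map_mul,
      Complex.conj_I, Complex.conj_ofReal]
    push_cast
    ring_nf
  rw [kernelWeight, hn, hconj]
  have hge := norm_one_sub_mul_exp_ge (ρ := s * r) (θ := -θ) (by positivity) hsr.le
    (by rwa [abs_neg])
  rw [abs_neg] at hge
  set m := ‖(1 - ((s * r : ℝ) : ℂ) * Complex.exp ((-θ : ℝ) * Complex.I) : ℂ)‖ with hm
  set y := 1 - s * r + |θ| with hy
  have hy0 : 0 < y := by
    have := abs_nonneg θ
    linarith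
  have h1r : 0 < √(1 - r) := sqrt_pos.2 (by linarith)
  have hsy : 0 < √y := sqrt_pos.2 hy0
  have h6 : √6 ≤ 5 / 2 := by
    rw [sqrt_le_left (by norm_num)]
    norm_num
  have h7 : y * √y ≤ 15 * (m * √m) := by
    have e1 : √(y / 6) ≤ √m := sqrt_le_sqrt hge
    have e2 : √y = √6 * √(y / 6) := by
      rw [← sqrt_mul (by norm_num)]
      congr 1
      field_simp
    have e3 : y * √y = (y / 6) * √(y / 6) * (6 * √6) := by rw [e2]; ring
    rw [e3]
    have e4 : (y / 6) * √(y / 6) ≤ m * √m := by gcongr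
    have e5 : 0 ≤ (y / 6) * √(y / 6) := by positivity
    nlinarith [sqrt_nonneg 6]
  have hm0 : 0 < m * √m := by
    have : 0 < y * √y := by positivity
    linarith
  rw [div_mul_eq_mul_div, mul_inv, ← div_eq_mul_inv]
  gcongr
  rw [← div_eq_mul_inv, inv_eq_one_div, div_le_div_iff₀ hm0 (by positivity)]
  linarith

open Real in
/-- The kernel weight has logarithmic mass. -/
theorem lintegral_kernelWeight_le {a : ℂ} (ha : ‖a‖ < 1) :
    ∫⁻ z in ball (0 : ℂ) 1, ENNReal.ofReal (kernelWeight a z) ≤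
      ENNReal.ofReal (120 * (log (1 / (1 - ‖a‖ ^ 2)) + 5)) := by
  obtain ⟨c, hc, hac⟩ : ∃ c : ℂ, ‖c‖ = 1 ∧ a = ‖a‖ * c := by
    rcases eq_or_ne a 0 with rfl | h
    · exact ⟨1, by simp, by simp⟩
    · have h0 : (‖a‖ : ℂ) ≠ 0 := by exact_mod_cast norm_ne_zero_iff.2 h
      exact ⟨a / ‖a‖, by simp [h], by field_simp⟩
  have hrot := lintegral_kernelWeight_rotate hc ‖a‖
  rw [← hac] at hrot
  rw [hrot]
  set s := ‖a‖ with hs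
  have hs0 : 0 ≤ s := norm_nonneg a
  have hmeas : Measurable fun z => ENNReal.ofReal (kernelWeight s z) :=
    (measurable_kernelWeight s).ennreal_ofReal
  rw [← lintegral_indicator measurableSet_ball, lintegral_eq_lintegral_polar _
    (hmeas.indicator measurableSet_ball)]
  have hinner : ∀ r ∈ Ioi (0 : ℝ), ∫⁻ θ in Ioo (-π) π, ENNReal.ofReal r *
      (ball (0 : ℂ) 1).indicator (fun z => ENNReal.ofReal (kernelWeight s z)) (circleMap 0 r θ) ≤
      (Iio (1 : ℝ)).indicator (fun r => ENNReal.ofReal 120 *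
        ENNReal.ofReal ((√(1 - r) * √(1 - r + (1 - s)))⁻¹)) r := by
    intro r hr
    have hr0 : 0 < r := hr
    have hn : ∀ θ, ‖circleMap 0 r θ‖ = r := fun θ => by simp [abs_of_pos hr0]
    by_cases h : r < 1
    · rw [indicator_of_mem (show r ∈ Iio (1 : ℝ) from h)]
      have hsr : 0 < 1 - s * r := by nlinarith
      have h1r : 0 < √(1 - r) := sqrt_pos.2 (by linarith)
      calc ∫⁻ θ in Ioo (-π) π, ENNReal.ofReal r *
            (ball (0 : ℂ) 1).indicator (fun z => ENNReal.ofReal (kernelWeight s z))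
              (circleMap 0 r θ)
          ≤ ∫⁻ θ in Ioo (-π) π, ENNReal.ofReal (15 / √(1 - r)) *
              ENNReal.ofReal (((1 - s * r + |θ|) * √(1 - s * r + |θ|))⁻¹) := by
            refine setLIntegral_mono' measurableSet_Ioo fun θ hθ => ?_
            rw [indicator_of_mem (by rw [mem_ball_zero_iff, hn]; exact h)]
            refine le_trans (mul_le_of_le_one_left' ?_) ((ENNReal.ofReal_le_ofReal
              (kernelWeight_circleMap_le hs0 ha hr0 h (abs_le.2 ⟨hθ.1.le, hθ.2.le⟩))).trans_eq
              (ENNReal.ofReal_mul (by positivity)))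
            rw [← ENNReal.ofReal_one]
            exact ENNReal.ofReal_le_ofReal h.le
        _ = ENNReal.ofReal (15 / √(1 - r)) * ∫⁻ θ in Ioo (-π) π,
              ENNReal.ofReal (((1 - s * r + |θ|) * √(1 - s * r + |θ|))⁻¹) :=
            lintegral_const_mul _ (by fun_prop)
        _ ≤ ENNReal.ofReal (15 / √(1 - r)) * ENNReal.ofReal (4 / √(1 - s * r)) :=
            mul_le_mul_right (lintegral_angular_le hsr) _
        _ ≤ _ := by
            rw [← ENNReal.ofReal_mul (by positivity), ← ENNReal.ofReal_mul (by positivity)]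
            apply ENNReal.ofReal_le_ofReal
            have hq : 0 < 1 - r + (1 - s) := by linarith
            -- Both 1 - r and 1 - s are at most 1 - sr; this puts the radial integrand into a form
            -- with an explicit primitive.
            have e1 : √(1 - r + (1 - s)) ≤ 2 * √(1 - s * r) := by
              rw [sqrt_le_left (by positivity), mul_pow, sq_sqrt hsr.le]
              nlinarith
            have e2 : 0 < √(1 - r + (1 - s)) := sqrt_pos.2 hq
            have e3 : 0 < √(1 - s * r) := sqrt_pos.2 hsr
            rw [div_mul_div_comm, ← div_eq_mul_inv, div_le_div_iff₀ (by positivity) (by positivity)]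
            nlinarith [mul_le_mul_of_nonneg_left e1 h1r.le]
    · rw [indicator_of_notMem (show r ∉ Iio (1 : ℝ) from h)]
      have : ∀ θ, ENNReal.ofReal r * (ball (0 : ℂ) 1).indicator
          (fun z => ENNReal.ofReal (kernelWeight s z)) (circleMap 0 r θ) = 0 := by
        intro θ
        rw [indicator_of_notMem (by rw [mem_ball_zero_iff, hn]; exact h), mul_zero]
      simp [this]
  refine (setLIntegral_mono' measurableSet_Ioi hinner).trans ?_
  rw [setLIntegral_indicator measurableSet_Iio, inter_comm, Ioi_inter_Iio,
    lintegral_const_mul _ (by fun_prop)]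
  refine (mul_le_mul_right (lintegral_radial_le (q := 1 - s) (by linarith) (by linarith)) _).trans ?_
  rw [← ENNReal.ofReal_mul (by norm_num)]
  apply ENNReal.ofReal_le_ofReal
  have h1 : 0 < 1 - s := by linarith
  have h2 : log (1 / (1 - s)) ≤ log (1 / (1 - s ^ 2)) + 1 := by
    have e1 : 1 - s ^ 2 = (1 - s) * (1 + s) := by ring
    rw [e1, log_div one_ne_zero h1.ne', log_div one_ne_zero (by positivity),
      log_mul h1.ne' (by positivity)]
    have := log_le_sub_one_of_pos (show 0 < 1 + s by positivity)
    linarith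
  linarith

open Real in
/-- The logarithmic energy of an annulus. -/
theorem lintegral_annulus_le {ρ R : ℝ} (hρ : 0 < ρ) (hR : ρ ≤ R) (w : ℂ) :
    ∫⁻ y in {y | ρ ≤ ‖y - w‖ ∧ ‖y - w‖ < R}, ENNReal.ofReal ((‖y - w‖ ^ 2)⁻¹) ≤
      ENNReal.ofReal (2 * π * log (R / ρ)) := by
  have hm : ∀ v : ℂ, MeasurableSet {y : ℂ | ρ ≤ ‖y - v‖ ∧ ‖y - v‖ < R} := fun v =>
    (measurableSet_le (f := fun _ : ℂ => ρ) (g := fun y => ‖y - v‖) (by fun_prop)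
      (by fun_prop)).inter (measurableSet_lt (f := fun y : ℂ => ‖y - v‖) (g := fun _ => R)
      (by fun_prop) (by fun_prop))
  have hm0 : MeasurableSet {y : ℂ | ρ ≤ ‖y‖ ∧ ‖y‖ < R} := by simpa using hm 0
  have htrans : ∫⁻ y in {y | ρ ≤ ‖y - w‖ ∧ ‖y - w‖ < R}, ENNReal.ofReal ((‖y - w‖ ^ 2)⁻¹) =
      ∫⁻ y, {y : ℂ | ρ ≤ ‖y‖ ∧ ‖y‖ < R}.indicator
        (fun y => ENNReal.ofReal ((‖y‖ ^ 2)⁻¹)) y := by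
    rw [← lintegral_sub_right_eq_self (μ := (volume : Measure ℂ)) _ w,
      ← lintegral_indicator (hm w)]
    rfl
  rw [htrans, lintegral_eq_lintegral_polar _ (Measurable.indicator (by fun_prop) hm0)]
  have hinner : ∀ r ∈ Ioi (0 : ℝ), ∫⁻ θ in Ioo (-π) π, ENNReal.ofReal r *
      {y : ℂ | ρ ≤ ‖y‖ ∧ ‖y‖ < R}.indicator (fun y => ENNReal.ofReal ((‖y‖ ^ 2)⁻¹))
        (circleMap 0 r θ) ≤
      (Ico ρ R).indicator (fun r => ENNReal.ofReal (2 * π * r⁻¹)) r := by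
    intro r hr
    have hr0 : 0 < r := hr
    have hn : ∀ θ, ‖circleMap 0 r θ‖ = r := fun θ => by simp [abs_of_pos hr0]
    by_cases h : r ∈ Ico ρ R
    · rw [indicator_of_mem h]
      have : ∀ θ, ENNReal.ofReal r * {y : ℂ | ρ ≤ ‖y‖ ∧ ‖y‖ < R}.indicator
          (fun y => ENNReal.ofReal ((‖y‖ ^ 2)⁻¹)) (circleMap 0 r θ) = ENNReal.ofReal r⁻¹ := by
        intro θ
        rw [indicator_of_mem (by rw [mem_ofPred_eq, hn]; exact h), hn,
          ← ENNReal.ofReal_mul hr0.le]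
        congr 1
        field_simp
      simp_rw [this]
      rw [lintegral_const, Measure.restrict_apply_univ, Real.volume_Ioo,
        ← ENNReal.ofReal_mul (by positivity)]
      exact ENNReal.ofReal_le_ofReal (le_of_eq (by ring))
    · rw [indicator_of_notMem h]
      have : ∀ θ, ENNReal.ofReal r * {y : ℂ | ρ ≤ ‖y‖ ∧ ‖y‖ < R}.indicator
          (fun y => ENNReal.ofReal ((‖y‖ ^ 2)⁻¹)) (circleMap 0 r θ) = 0 := by
        intro θ
        rw [indicator_of_notMem (by rw [mem_ofPred_eq, hn]; exact h), mul_zero]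
      simp [this]
  refine (setLIntegral_mono' measurableSet_Ioi hinner).trans ?_
  rw [setLIntegral_indicator measurableSet_Ico]
  refine (lintegral_mono_set inter_subset_left).trans ?_
  rw [setLIntegral_congr Ioo_ae_eq_Ico.symm]
  refine (lintegral_ofReal_deriv_le (F := fun r => 2 * π * log r) hR ?_ ?_ ?_).trans ?_
  · exact continuousOn_const.mul (continuousOn_log.mono fun x hx => by
      simpa using (hρ.trans_le hx.1).ne')
  · exact fun x hx => (hasDerivAt_log (hρ.trans hx.1).ne').const_mul _
  · intro x hx
    have := hρ.trans hx.1
    positivity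
  · rw [log_div (hρ.trans_le hR).ne' hρ.ne', mul_sub]

/-! ### Pointwise quadratic inequalities. -/

/-- Put W = m^{-3/2} x^{-1/2}. Bounding g^{1/3} by a multiple of t x^{-1/3} turns g/m into a
multiple of t · W^{2/3} (g²)^{1/3}, and weighted AM-GM applies. The cube in the hypothesis is what
supplies the extra factor t; the proof argues by contradiction to avoid fractional powers. -/
theorem le_quadratic_of_le_div {x m g t : ℝ} (hx : 0 < x) (hxm : x ≤ m) (hg : 0 ≤ g) (ht : 0 < t)
    (h : g * x ≤ 32 * t ^ 3) :
    t * (m⁻¹ * g) ≤ 4 * t ^ 2 * ((m * √m * √x)⁻¹ + g ^ 2) := by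
  have hm := hx.trans_le hxm
  have hsm : 0 < √m := Real.sqrt_pos.2 hm
  have hsx : 0 < √x := Real.sqrt_pos.2 hx
  by_contra! hcon
  set p := (√m)⁻¹ with hp
  set y := (√x)⁻¹ with hy
  have hp0 : 0 < p := inv_pos.2 hsm
  have hy0 : 0 < y := inv_pos.2 hsx
  have e1 : m⁻¹ = p ^ 2 := by rw [hp, inv_pow, Real.sq_sqrt hm.le]
  have e2 : x * y ^ 2 = 1 := by
    rw [hy, inv_pow, Real.sq_sqrt hx.le, mul_inv_cancel₀ hx.ne']
  have e3 : (m * √m * √x)⁻¹ = p ^ 3 * y := by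
    rw [mul_inv, mul_inv, e1, ← hp, ← hy]
    ring
  rw [e1, e3] at hcon
  have h0 : 4 * t * (p ^ 3 * y + g ^ 2) < p ^ 2 * g := by
    have : t * (4 * t * (p ^ 3 * y + g ^ 2)) < t * (p ^ 2 * g) := by linarith
    exact lt_of_mul_lt_mul_left this ht.le
  have hg0 : 0 < g := by
    rcases hg.eq_or_lt with h' | h'
    · rw [← h'] at h0
      have : 0 < 4 * t * (p ^ 3 * y + 0 ^ 2) := by positivity
      linarith
    · exact h'
  have h1 : 4 * t * g < p ^ 2 := by
    have : 0 < 4 * t * (p ^ 3 * y) := by positivity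
    have : (4 * t * g) * g < p ^ 2 * g := by nlinarith
    exact lt_of_mul_lt_mul_right this hg
  have h2 : 4 * t * (p * y) < g := by
    have : 0 < 4 * t * g ^ 2 := by positivity
    have : p ^ 2 * (4 * t * (p * y)) < p ^ 2 * g := by nlinarith
    exact lt_of_mul_lt_mul_left this (by positivity)
  have h3 : g ≤ 32 * t ^ 3 * y ^ 2 := by
    have := mul_le_mul_of_nonneg_right h (sq_nonneg y)
    rwa [mul_assoc, e2, mul_one] at this
  have h4 : (4 * t * (p * y)) ^ 2 < g ^ 2 := by gcongr
  have h5 : p ^ 2 * g ≤ p ^ 2 * (32 * t ^ 3 * y ^ 2) := by gcongr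
  have h6 : p ^ 2 * g < 2 * t * g * g := by nlinarith
  have h7 : p ^ 2 < 2 * t * g := lt_of_mul_lt_mul_right h6 hg
  nlinarith

/-- AM-GM with a free parameter β, after m⁻² ≤ m^{-3/2} x^{-1/2}. -/
theorem le_quadratic {x m g t β : ℝ} (hx : 0 < x) (hxm : x ≤ m) (hβ : 0 < β) :
    t * (m⁻¹ * g) ≤ β * (m * √m * √x)⁻¹ + t ^ 2 / (4 * β) * g ^ 2 := by
  have hm := hx.trans_le hxm
  have hsm : 0 < √m := Real.sqrt_pos.2 hm
  have hsx : 0 < √x := Real.sqrt_pos.2 hx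
  have h1 : (m⁻¹) ^ 2 ≤ (m * √m * √x)⁻¹ := by
    rw [inv_pow]
    refine inv_anti₀ (by positivity) ?_
    calc m * √m * √x ≤ m * √m * √m := by gcongr
      _ = m ^ 2 := by rw [mul_assoc, Real.mul_self_sqrt hm.le, sq]
  have h2 : β * (m⁻¹) ^ 2 ≤ β * (m * √m * √x)⁻¹ := by gcongr
  have h3 : 0 ≤ β * (m⁻¹ - t * g / (2 * β)) ^ 2 := by positivity
  have h4 : β * (m⁻¹ - t * g / (2 * β)) ^ 2 =
      β * (m⁻¹) ^ 2 + t ^ 2 / (4 * β) * g ^ 2 - t * (m⁻¹ * g) := by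
    field_simp
    ring
  linarith

/-! ### Bounding the logarithm by the thick energy. -/

section LogBound

variable {φ : ℂ → ℂ}

open Real in
/-- Bergman projection of the logarithmic derivative, split at the scale `t ^ 3`. -/
theorem norm_log_le_energy (hφ : φ ∈ classSb) {L : ℂ → ℂ} (hL : IsLogBranch φ L) {a : ℂ}
    (ha : a ∈ ball (0 : ℂ) 1) {R t β : ℝ} (hR : ∀ z ∈ ball (0 : ℂ) 1, ‖φ z - φ a‖ < R)
    (ht : 0 < t) (hβ : 0 < β) (hfin : thickEnergy (φ '' ball 0 1) (t ^ 3) (φ a) < ⊤) :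
    t * (π * ‖L a - L 0 + log (1 - ‖a‖ ^ 2)‖) ≤
      (β + 4 * t ^ 2) * (120 * (log (1 / (1 - ‖a‖ ^ 2)) + 5)) +
        (t ^ 2 / (4 * β) * (thickEnergy (φ '' ball 0 1) (t ^ 3) (φ a)).toReal +
          4 * t ^ 2 * (2 * π * log (R / (infDist (φ a) (φ '' ball 0 1)ᶜ / 2)))) := by
  set Ω := φ '' ball 0 1 with hΩ
  have hΩo : IsOpen Ω := classSb_isOpen_image hφ
  set w := φ a with hw
  have hwΩ : w ∈ Ω := mem_image_of_mem φ ha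
  have hd : 0 < infDist w Ωᶜ := classSb_infDist_pos hφ hwΩ
  set ρ := infDist w Ωᶜ / 2 with hρd
  have hρ : 0 < ρ := by positivity
  have ha1 := mem_ball_zero_iff.1 ha
  have hballs : ball w (infDist w Ωᶜ) ⊆ Ω := fun y hy => by
    by_contra h
    have := infDist_le_dist_of_mem (x := w) (show y ∈ Ωᶜ from h)
    rw [mem_ball, dist_comm] at hy
    linarith
  have hsub : closedBall w ρ ⊆ Ω := (closedBall_subset_ball (by linarith)).trans hballs
  have hρR : ρ ≤ R := by
    by_contra! hlt
    obtain ⟨z, hz, hzw⟩ := hsub (show w + ρ ∈ closedBall w ρ by simp [abs_of_pos hρ])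
    have := hR z hz
    rw [hzw] at this
    simp [abs_of_pos hρ] at this
    linarith
  obtain ⟨Γ, hΓ0, hΓ, hΓL⟩ := hL.exists_log_dslope hφ ha
  have hrep := integral_bergman_logDeriv hφ ha1 hρ hsub hΓ0 hΓ
  rw [hΓL] at hrep
  set E := ball (0 : ℂ) 1 ∩ {z | ρ ≤ ‖φ z - w‖} with hE
  have hEm : MeasurableSet E := by
    have := (measurableSet_ball (x := (0 : ℂ)) (ε := 1)).diff (((hφ.1.1.continuousOn.sub
      (continuousOn_const (c := w))).norm).isOpen_inter_preimage isOpen_ball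
      (isOpen_Iio (a := ρ))).measurableSet
    convert this using 1
    ext z
    simp only [hE, mem_inter_iff, mem_ofPred_eq, Set.mem_sdiff, mem_preimage, mem_Iio, not_and,
      not_lt]
    tauto
  set q : ℂ → ENNReal := fun y => ENNReal.ofReal ((‖y - w‖ ^ 2)⁻¹) with hq
  have hqm : Measurable q := by fun_prop
  set T := {y | y ∈ Ω ∧ t ^ 3 * ‖y - w‖ < infDist y Ωᶜ ∧ infDist w Ωᶜ / 2 ≤ ‖y - w‖} with hT
  have hTm : MeasurableSet T := measurableSet_thick hΩo _ _
  set F : ℂ → ENNReal := fun y => ENNReal.ofReal (t ^ 2 / (4 * β)) * T.indicator q y +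
    ENNReal.ofReal (4 * t ^ 2) * q y with hF
  have hpt : ∀ z ∈ E, ENNReal.ofReal t *
      ‖a / (1 - a * starRingEnd ℂ z) * (deriv φ z / (φ z - w))‖ₑ ≤
      ENNReal.ofReal (β + 4 * t ^ 2) * ENNReal.ofReal (kernelWeight a z) +
        ENNReal.ofReal (‖deriv φ z‖ ^ 2) * F (φ z) := by
    rintro z ⟨hz, hzρ⟩
    have hz1 := mem_ball_zero_iff.1 hz
    obtain ⟨-, h2, -⟩ := one_sub_mul_conj_ne_zero ha1 hz1
    have hx : 0 < 1 - ‖z‖ := by linarith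
    have hm := hx.trans_le h2
    have hden : 0 < ‖φ z - w‖ := hρ.trans_le hzρ
    set g := ‖deriv φ z‖ / ‖φ z - w‖ with hg
    have hg0 : 0 ≤ g := by positivity
    have hle : t * ‖a / (1 - a * starRingEnd ℂ z) * (deriv φ z / (φ z - w))‖ ≤
        t * (‖1 - a * starRingEnd ℂ z‖⁻¹ * g) := by
      rw [norm_mul, norm_div, norm_div, ← hg, div_eq_mul_inv]
      have : ‖a‖ * ‖1 - a * starRingEnd ℂ z‖⁻¹ ≤ ‖1 - a * starRingEnd ℂ z‖⁻¹ :=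
        mul_le_of_le_one_left (by positivity) ha1.le
      gcongr
    have hW : 0 ≤ kernelWeight a z := by unfold kernelWeight; positivity
    have hqg : ENNReal.ofReal (‖deriv φ z‖ ^ 2) * q (φ z) = ENNReal.ofReal (g ^ 2) := by
      rw [hq, ← ENNReal.ofReal_mul (by positivity), hg, div_pow, div_eq_mul_inv]
    rw [← ofReal_norm, ← ENNReal.ofReal_mul ht.le, hF]
    simp only
    -- Thick points use the free parameter β. At thin points the Koebe estimate gives g(1-|z|) ≤
    -- 32t³, and the coefficient 4t² suffices.
    by_cases hzT : φ z ∈ T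
    · have := hle.trans (le_quadratic (g := g) (t := t) hx h2 hβ)
      rw [← kernelWeight] at this
      rw [indicator_of_mem hzT, mul_add, mul_left_comm, hqg, mul_left_comm, hqg,
        ← ENNReal.ofReal_mul (by positivity), ← ENNReal.ofReal_mul (by positivity),
        ← ENNReal.ofReal_mul (by positivity), ← ENNReal.ofReal_add (by positivity) (by positivity),
        ← ENNReal.ofReal_add (by positivity) (by positivity)]
      refine ENNReal.ofReal_le_ofReal (this.trans ?_)
      have e1 : 0 ≤ 4 * t ^ 2 * kernelWeight a z := by positivity
      have e2 : 0 ≤ 4 * t ^ 2 * g ^ 2 := by positivity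
      linarith
    · have hthin : infDist (φ z) Ωᶜ ≤ t ^ 3 * ‖φ z - w‖ := by
        by_contra! h
        exact hzT ⟨mem_image_of_mem φ hz, h, hzρ⟩
      have hgx : g * (1 - ‖z‖) ≤ 32 * t ^ 3 := by
        rw [hg, div_mul_eq_mul_div, div_le_iff₀ hden]
        have := norm_deriv_mul_le_infDist hφ hz
        linarith
      have := hle.trans (le_quadratic_of_le_div hx h2 hg0 ht hgx)
      rw [← kernelWeight] at this
      rw [indicator_of_notMem hzT, mul_zero, zero_add, mul_left_comm, hqg,
        ← ENNReal.ofReal_mul (by positivity), ← ENNReal.ofReal_mul (by positivity),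
        ← ENNReal.ofReal_add (by positivity) (by positivity)]
      refine ENNReal.ofReal_le_ofReal (this.trans ?_)
      have e1 : 0 ≤ β * kernelWeight a z := by positivity
      linarith
  have himg : φ '' E ⊆ {y | ρ ≤ ‖y - w‖ ∧ ‖y - w‖ < R} := by
    rintro _ ⟨z, hz, rfl⟩
    exact ⟨hz.2, hR z hz.1⟩
  have hint : ENNReal.ofReal (t * (π * ‖L a - L 0 + log (1 - ‖a‖ ^ 2)‖)) ≤
      ENNReal.ofReal (β + 4 * t ^ 2) *
        ENNReal.ofReal (120 * (log (1 / (1 - ‖a‖ ^ 2)) + 5)) +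
      (ENNReal.ofReal (t ^ 2 / (4 * β)) * thickEnergy Ω (t ^ 3) w +
        ENNReal.ofReal (4 * t ^ 2) * ENNReal.ofReal (2 * π * log (R / ρ))) := by
    calc ENNReal.ofReal (t * (π * ‖L a - L 0 + log (1 - ‖a‖ ^ 2)‖))
        = ENNReal.ofReal t *
          ‖∫ z in E, a / (1 - a * starRingEnd ℂ z) * (deriv φ z / (φ z - w))‖ₑ := by
          rw [hrep, ← ofReal_norm, norm_mul, Complex.norm_real, Real.norm_of_nonneg pi_pos.le,
            ENNReal.ofReal_mul ht.le]
      _ ≤ ENNReal.ofReal t *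
          ∫⁻ z in E, ‖a / (1 - a * starRingEnd ℂ z) * (deriv φ z / (φ z - w))‖ₑ :=
          mul_le_mul_right (enorm_integral_le_lintegral_enorm _) _
      _ = ∫⁻ z in E, ENNReal.ofReal t *
          ‖a / (1 - a * starRingEnd ℂ z) * (deriv φ z / (φ z - w))‖ₑ :=
          (lintegral_const_mul' _ _ ENNReal.ofReal_ne_top).symm
      _ ≤ ∫⁻ z in E, (ENNReal.ofReal (β + 4 * t ^ 2) * ENNReal.ofReal (kernelWeight a z) +
            ENNReal.ofReal (‖deriv φ z‖ ^ 2) * F (φ z)) := setLIntegral_mono' hEm hpt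
      _ = ENNReal.ofReal (β + 4 * t ^ 2) * (∫⁻ z in E, ENNReal.ofReal (kernelWeight a z)) +
            ∫⁻ y in φ '' E, F y := by
          have hk := (measurable_kernelWeight a).ennreal_ofReal
          rw [lintegral_add_left (hk.const_mul _), lintegral_const_mul _ hk,
            lintegral_image_of_hasDerivAt hEm
              (fun z hz => classSb_hasDerivAt hφ z hz.1) (hφ.1.2.1.mono inter_subset_left)]
      _ ≤ _ := by
          refine add_le_add (mul_le_mul_right ((lintegral_mono_set inter_subset_left).trans
            (lintegral_kernelWeight_le ha1)) _) ?_
          rw [hF, lintegral_add_left ((hqm.indicator hTm).const_mul _),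
            lintegral_const_mul _ (hqm.indicator hTm), lintegral_const_mul _ hqm]
          refine add_le_add (mul_le_mul_right ?_ _) (mul_le_mul_right ?_ _)
          · rw [lintegral_indicator hTm]
            exact lintegral_mono' (Measure.restrict_mono_measure Measure.restrict_le_self T) le_rfl
          · exact (lintegral_mono_set himg).trans (lintegral_annulus_le hρ hρR w)
  have hN : 0 ≤ log (1 / (1 - ‖a‖ ^ 2)) := by
    apply log_nonneg
    rw [le_div_iff₀ (by nlinarith [norm_nonneg a])]
    nlinarith [norm_nonneg a]
  have hlog : 0 ≤ log (R / ρ) := log_nonneg (by rwa [one_le_div hρ])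
  rw [← ENNReal.ofReal_toReal hfin.ne, ← ENNReal.ofReal_mul (by positivity),
    ← ENNReal.ofReal_mul (by positivity), ← ENNReal.ofReal_mul (by positivity),
    ← ENNReal.ofReal_add (by positivity) (by positivity),
    ← ENNReal.ofReal_add (by positivity) (by positivity)] at hint
  exact (ENNReal.ofReal_le_ofReal_iff (by positivity)).1 hint

/-- Compactness handles |z| ≤ 1/2. Beyond that, injectivity keeps φ out of a neighbourhood of 0
already covered by the smaller disc. -/
theorem exists_le_norm_dslope (hφ : φ ∈ classSb) :
    ∃ c : ℝ, 0 < c ∧ ∀ z ∈ ball (0 : ℂ) 1, c ≤ ‖dslope φ 0 z‖ := by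
  have hz0 : (0 : ℂ) ∈ ball (0 : ℂ) 1 := mem_ball_self one_pos
  have hne : ∀ z ∈ ball (0 : ℂ) 1, dslope φ 0 z ≠ 0 := fun z hz =>
    dslope_ne_zero_of_injOn isOpen_ball hφ.1.1 hφ.1.2.1 hz0 hz
  have hsub : closedBall (0 : ℂ) (1 / 2) ⊆ ball 0 1 := closedBall_subset_ball (by norm_num)
  have hcont : ContinuousOn (dslope φ 0) (closedBall 0 (1 / 2)) :=
    ((continuousOn_dslope (isOpen_ball.mem_nhds hz0)).2
      ⟨hφ.1.1.continuousOn, hφ.1.1.differentiableAt (isOpen_ball.mem_nhds hz0)⟩).mono hsub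
  obtain ⟨z₁, hz₁, hmin⟩ := (isCompact_closedBall (0 : ℂ) (1 / 2)).exists_isMinOn
    ⟨0, mem_closedBall_self (by norm_num)⟩ hcont.norm
  have hopen : IsOpen (φ '' ball 0 (1 / 2)) :=
    isOpen_image_of_injOn isOpen_ball hφ.1.1 hφ.1.2.1 isOpen_ball (ball_subset_ball (by norm_num))
  obtain ⟨r, hr, hrsub⟩ := Metric.isOpen_iff.1 hopen 0 ⟨0, mem_ball_self (by norm_num), hφ.1.2.2.1⟩
  refine ⟨min ‖dslope φ 0 z₁‖ r, lt_min (norm_pos_iff.2 (hne _ (hsub hz₁))) hr, fun z hz => ?_⟩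
  by_cases h : z ∈ closedBall (0 : ℂ) (1 / 2)
  · exact (min_le_left _ _).trans (hmin h)
  · have hz1 := mem_ball_zero_iff.1 hz
    have hz2 : 1 / 2 < ‖z‖ := by simpa using h
    have hzne : z ≠ 0 := norm_pos_iff.1 (by linarith)
    have hrz : r ≤ ‖φ z‖ := by
      by_contra! hlt
      obtain ⟨y, hy, hyz⟩ := hrsub (mem_ball_zero_iff.2 hlt)
      have := hφ.1.2.1 (ball_subset_ball (by norm_num) hy) hz hyz
      rw [this, mem_ball_zero_iff] at hy
      linarith
    refine (min_le_right _ _).trans ?_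
    rw [dslope_of_ne _ hzne, slope_def_field, hφ.1.2.2.1, sub_zero, sub_zero, norm_div]
    exact hrz.trans (le_div_self (norm_nonneg _) (by linarith) hz1.le)

open Real in
theorem exists_log_div_infDist_le (hφ : φ ∈ classSb) :
    ∃ R B : ℝ, 0 ≤ B ∧ ∀ a ∈ ball (0 : ℂ) 1, (∀ z ∈ ball (0 : ℂ) 1, ‖φ z - φ a‖ < R) ∧
      log (R / (infDist (φ a) (φ '' ball 0 1)ᶜ / 2)) ≤
        B + 32 * (log (1 / (1 - ‖a‖ ^ 2)) + 1) := by
  obtain ⟨M, hM⟩ := hφ.2.exists_norm_le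
  have hM' : ∀ z ∈ ball (0 : ℂ) 1, ‖φ z‖ ≤ M := fun z hz => hM _ (mem_image_of_mem φ hz)
  have hz0 : (0 : ℂ) ∈ ball (0 : ℂ) 1 := mem_ball_self one_pos
  have hM0 : 0 ≤ M := (norm_nonneg _).trans (hM' 0 hz0)
  set d := infDist 0 (φ '' ball 0 1)ᶜ with hd
  have hd0 : 0 < d := classSb_infDist_pos hφ ⟨0, hz0, hφ.1.2.2.1⟩
  refine ⟨2 * M + 1, |log ((2 * M + 1) * 2 / d)|, abs_nonneg _, fun a ha => ⟨fun z hz => ?_, ?_⟩⟩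
  · have h1 := norm_sub_le (φ z) (φ a)
    have h2 := hM' z hz
    have h3 := hM' a ha
    linarith
  · have ha1 := mem_ball_zero_iff.1 ha
    have h1 : 0 < 1 - ‖a‖ := by linarith
    have hlow := infDist_lower_bound hφ ha
    rw [← hd] at hlow
    have hpos : 0 < d * (1 - ‖a‖) ^ 32 := by positivity
    have hpos' := hpos.trans_le hlow
    calc log ((2 * M + 1) / (infDist (φ a) (φ '' ball 0 1)ᶜ / 2))
        ≤ log ((2 * M + 1) * 2 / d * (1 / (1 - ‖a‖)) ^ 32) := by
          apply log_le_log (by positivity)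
          calc (2 * M + 1) / (infDist (φ a) (φ '' ball 0 1)ᶜ / 2)
              ≤ (2 * M + 1) / (d * (1 - ‖a‖) ^ 32 / 2) := by gcongr
            _ = _ := by field_simp
      _ = log ((2 * M + 1) * 2 / d) + 32 * log (1 / (1 - ‖a‖)) := by
          rw [log_mul (by positivity) (by positivity), log_pow]
          norm_num
      _ ≤ _ := by
          have e1 : 1 - ‖a‖ ^ 2 = (1 - ‖a‖) * (1 + ‖a‖) := by ring
          have e2 : log (1 / (1 - ‖a‖)) ≤ log (1 / (1 - ‖a‖ ^ 2)) + 1 := by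
            rw [e1, log_div one_ne_zero h1.ne', log_div one_ne_zero (by positivity),
              log_mul h1.ne' (by positivity)]
            have := log_le_sub_one_of_pos (show 0 < 1 + ‖a‖ by positivity)
            linarith
          have e3 := le_abs_self (log ((2 * M + 1) * 2 / d))
          linarith

open Real in
/-- The logarithm `log (φ'(a) (1 - |a|²) a / φ(a))` is controlled by the energy of the thick part
of the image domain, with coefficients of the order of those in the integral estimate. -/
theorem exists_norm_log_le {s : ℝ} (hs : 0 < s) (hφ : φ ∈ classSb) {L : ℂ → ℂ}
    (hL : IsLogBranch φ L) {t : ℝ} (ht : 0 < t) (ht1 : t < 1 / 10)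
    (hfin : ∀ w ∈ φ '' ball 0 1, thickEnergy (φ '' ball 0 1) (t ^ 3) w < ⊤) :
    ∃ B : ℝ, ∀ a ∈ ball (0 : ℂ) 1,
      t * ‖L a - L 0 + log (1 - ‖a‖ ^ 2)‖ ≤
        (40 * (s⁻¹ + 4) + 256) * t ^ 2 * log (1 / t) * log (1 / (1 - ‖a‖ ^ 2)) + B +
          s / (log (12 / t ^ 3) + 1) *
            (thickEnergy (φ '' ball 0 1) (t ^ 3) (φ a)).toReal := by
  obtain ⟨R, B₀, hB₀, hRB⟩ := exists_log_div_infDist_le hφ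
  set l := log (1 / t) with hl
  have hl1 : 1 ≤ l := by
    rw [hl, le_log_iff_exp_le (by positivity), le_div_iff₀ ht]
    have := exp_one_lt_d9
    nlinarith
  have hl2 : log (12 / t ^ 3) + 1 ≤ 7 * l := by
    have e1 : log 12 ≤ 3 := by
      rw [log_le_iff_le_exp (by norm_num)]
      have e := exp_one_gt_d9
      have : exp 3 = exp 1 ^ 3 := by rw [← exp_nat_mul]; norm_num
      rw [this]
      calc (12 : ℝ) ≤ 2.7 ^ 3 := by norm_num
        _ ≤ _ := by gcongr; linarith
    have e2 : log (12 / t ^ 3) = log 12 + 3 * l := by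
      rw [hl, div_eq_mul_one_div, ← one_div_pow, log_mul (by norm_num) (by positivity), log_pow]
      norm_num
    rw [e2]
    linarith
  have hl3 : 0 < log (12 / t ^ 3) + 1 := by
    have : 0 ≤ log (12 / t ^ 3) := log_nonneg (by
      rw [le_div_iff₀ (by positivity), one_mul]
      calc t ^ 3 ≤ 1 ^ 3 := by gcongr; linarith
        _ ≤ 12 := by norm_num)
    linarith
  refine ⟨t ^ 2 * l * (200 * (s⁻¹ + 4) + 8 * B₀ + 256), fun a ha => ?_⟩
  obtain ⟨hR, hlog⟩ := hRB a ha
  have hβ : 0 < s⁻¹ * t ^ 2 * l := by positivity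
  have hmain := norm_log_le_energy hφ hL ha hR ht hβ (hfin _ (mem_image_of_mem φ ha))
  set T := (thickEnergy (φ '' ball 0 1) (t ^ 3) (φ a)).toReal with hT
  have hT0 : 0 ≤ T := ENNReal.toReal_nonneg
  set N := log (1 / (1 - ‖a‖ ^ 2)) with hN
  have hN0 : 0 ≤ N := by
    have := mem_ball_zero_iff.1 ha
    apply log_nonneg
    rw [le_div_iff₀ (by nlinarith [norm_nonneg a])]
    nlinarith [norm_nonneg a]
  set X := ‖L a - L 0 + log (1 - ‖a‖ ^ 2)‖ with hX
  have hpi := pi_gt_three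
  have hcoef : t ^ 2 / (4 * (s⁻¹ * t ^ 2 * l)) ≤ π * (s / (log (12 / t ^ 3) + 1)) := by
    have e1 : t ^ 2 / (4 * (s⁻¹ * t ^ 2 * l)) = s / (4 * l) := by field_simp
    have e2 : s / (7 * l) ≤ s / (log (12 / t ^ 3) + 1) := by gcongr
    have e3 : s / (4 * l) ≤ 3 * (s / (7 * l)) := by
      rw [← mul_div_assoc, div_le_div_iff₀ (by positivity) (by positivity)]
      nlinarith [mul_pos hs (show 0 < l by linarith)]
    rw [e1]
    have e4 : 0 ≤ s / (log (12 / t ^ 3) + 1) := by positivity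
    nlinarith
  have h1 : t ^ 2 / (4 * (s⁻¹ * t ^ 2 * l)) * T ≤ π * (s / (log (12 / t ^ 3) + 1)) * T := by
    gcongr
  have h2 : (s⁻¹ * t ^ 2 * l + 4 * t ^ 2) * (120 * (N + 5)) ≤
      π * (t ^ 2 * l * (40 * (s⁻¹ + 4) * (N + 5))) := by
    have e1 : s⁻¹ * t ^ 2 * l + 4 * t ^ 2 ≤ t ^ 2 * l * (s⁻¹ + 4) := by
      have : t ^ 2 * 1 ≤ t ^ 2 * l := by gcongr
      linarith
    calc (s⁻¹ * t ^ 2 * l + 4 * t ^ 2) * (120 * (N + 5))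
        ≤ t ^ 2 * l * (s⁻¹ + 4) * (120 * (N + 5)) := by gcongr
      _ = 3 * (t ^ 2 * l * (40 * (s⁻¹ + 4) * (N + 5))) := by ring
      _ ≤ _ := by gcongr
  have h3 : 4 * t ^ 2 * (2 * π * log (R / (infDist (φ a) (φ '' ball 0 1)ᶜ / 2))) ≤
      π * (t ^ 2 * l * (8 * (B₀ + 32 * (N + 1)))) := by
    calc 4 * t ^ 2 * (2 * π * log (R / (infDist (φ a) (φ '' ball 0 1)ᶜ / 2)))
        ≤ 4 * t ^ 2 * (2 * π * (B₀ + 32 * (N + 1))) := by gcongr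
      _ = π * (t ^ 2 * 1 * (8 * (B₀ + 32 * (N + 1)))) := by ring
      _ ≤ _ := by gcongr
  have h4 : π * (t * X) ≤ π * ((40 * (s⁻¹ + 4) + 256) * t ^ 2 * l * N +
      t ^ 2 * l * (200 * (s⁻¹ + 4) + 8 * B₀ + 256) +
        s / (log (12 / t ^ 3) + 1) * T) := by
    calc π * (t * X) = t * (π * X) := by ring
      _ ≤ _ := hmain
      _ ≤ _ := add_le_add h2 (add_le_add h1 h3)
      _ = _ := by ring
  exact le_of_mul_le_mul_left h4 pi_pos

end LogBound

/-! ### Conclusion. -/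

theorem theorem1p1 :
    ∃ C : ℝ, 0 < C ∧ ∃ δ : ℝ, 0 < δ ∧ ∀ φ ∈ classSb,
      (∃ L : ℂ → ℂ, IsLogBranch φ L) ∧
      ∀ L : ℂ → ℂ, IsLogBranch φ L → ∀ τ : ℂ, ‖τ‖ < δ →
        ∫⁻ z in ball (0 : ℂ) 1,
          ENNReal.ofReal (‖branchPow L (2 - τ) z‖ *
            (1 - ‖z‖ ^ 2) ^ (-τ.re + C * ‖τ‖ ^ 2 * Real.log (1 / ‖τ‖))) ∂areaMeasure < ⊤ := by
  obtain ⟨s, hs, hexp⟩ := exists_lintegral_exp_thickEnergy_le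
  -- 40 is the kernel constant 120 divided by 3 < π, and 256 = 8 · 32 comes from the annulus energy
  -- and the boundary distance exponent. The radius 1/10 guarantees log(1/t) ≥ 1.
  refine ⟨40 * (s⁻¹ + 4) + 256, by positivity, 1 / 10, by norm_num, fun φ hφ =>
    ⟨exists_isLogBranch hφ, fun L hL τ hτ => ?_⟩⟩
  set C := 40 * (s⁻¹ + 4) + 256 with hC
  set Ω := φ '' ball 0 1 with hΩ
  obtain ⟨c, hc, hcle⟩ := exists_le_norm_dslope hφ
  have hexpL : ∀ z ∈ ball (0 : ℂ) 1, Real.exp (L z).re ≤ ‖deriv φ z‖ / c := by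
    intro z hz
    rw [← Complex.norm_exp, hL.exp_eq hφ hz, norm_div]
    exact div_le_div_of_nonneg_left (norm_nonneg _) hc (hcle z hz)
  have hexpL2 : ∀ z ∈ ball (0 : ℂ) 1,
      Real.exp (2 * (L z).re) ≤ (c ^ 2)⁻¹ * ‖deriv φ z‖ ^ 2 := by
    intro z hz
    have : Real.exp (2 * (L z).re) = Real.exp (L z).re ^ 2 := by
      rw [← Real.exp_nat_mul]; norm_num
    rw [this]
    calc Real.exp (L z).re ^ 2 ≤ (‖deriv φ z‖ / c) ^ 2 := by gcongr; exact hexpL z hz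
      _ = _ := by ring
  -- The factor |φ'|² is kept as Jacobian, so that only an integral over the image remains.
  suffices h : ∃ (K : ℝ) (G : ℂ → ENNReal), ∫⁻ w in Ω, G w < ⊤ ∧
      ∀ z ∈ ball (0 : ℂ) 1, ENNReal.ofReal (‖branchPow L (2 - τ) z‖ *
        (1 - ‖z‖ ^ 2) ^ (-τ.re + C * ‖τ‖ ^ 2 * Real.log (1 / ‖τ‖))) ≤
        ENNReal.ofReal K * (ENNReal.ofReal (‖deriv φ z‖ ^ 2) * G (φ z)) by
    obtain ⟨K, G, hG, hle⟩ := h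
    rw [areaMeasure, Measure.restrict_smul, lintegral_smul_measure, smul_eq_mul]
    refine ENNReal.mul_lt_top ENNReal.ofReal_lt_top
      ((setLIntegral_mono' measurableSet_ball hle).trans_lt ?_)
    rw [lintegral_const_mul' _ _ ENNReal.ofReal_ne_top, ← lintegral_image_of_hasDerivAt
      measurableSet_ball (classSb_hasDerivAt hφ) hφ.1.2.1]
    exact ENNReal.mul_lt_top ENNReal.ofReal_lt_top hG
  have hvol : volume Ω < ⊤ := hφ.2.measure_lt_top
  have hpos : ∀ z ∈ ball (0 : ℂ) 1, 0 < 1 - ‖z‖ ^ 2 := fun z hz => by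
    have := mem_ball_zero_iff.1 hz
    nlinarith [norm_nonneg z]
  rcases eq_or_ne τ 0 with rfl | hτ0
  · refine ⟨(c ^ 2)⁻¹, fun _ => 1, by simpa using hvol, fun z hz => ?_⟩
    rw [mul_one, ← ENNReal.ofReal_mul (by positivity)]
    apply ENNReal.ofReal_le_ofReal
    have : ‖branchPow L (2 - 0) z‖ = Real.exp (2 * (L z).re) := by
      simp [branchPow, Complex.norm_exp]
    rw [this]
    simpa using hexpL2 z hz
  · set t := ‖τ‖ with ht
    have ht0 : 0 < t := norm_pos_iff.2 hτ0
    have ht3 : t ^ 3 < 1 := pow_lt_one₀ ht0.le (by linarith) (by norm_num)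
    obtain ⟨hfin, hint⟩ := hexp Ω (classSb_isOpen_image hφ) hφ.2 (t ^ 3) (by positivity) ht3
    obtain ⟨B, hB⟩ := exists_norm_log_le hs hφ hL ht0 hτ hfin
    refine ⟨(c ^ 2)⁻¹ * Real.exp (t * ‖L 0‖ + B), fun w => ENNReal.ofReal
      (Real.exp (s / (Real.log (12 / t ^ 3) + 1) * (thickEnergy Ω (t ^ 3) w).toReal)),
      hint.trans_lt (ENNReal.mul_lt_top (by simp) hvol), fun z hz => ?_⟩
    rw [← ENNReal.ofReal_mul (by positivity), ← ENNReal.ofReal_mul (by positivity)]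
    apply ENNReal.ofReal_le_ofReal
    have hz1 := hpos z hz
    have hBz := hB z hz
    set T := (thickEnergy Ω (t ^ 3) (φ z)).toReal
    set X := L z - L 0 + Real.log (1 - ‖z‖ ^ 2) with hX
    set N := Real.log (1 / (1 - ‖z‖ ^ 2)) with hN
    have hNlog : Real.log (1 - ‖z‖ ^ 2) = -N := by rw [hN, one_div, Real.log_inv, neg_neg]
    have hLz : L z = L 0 + X + N := by
      rw [hX, hNlog]
      push_cast
      ring
    -- The N part of L is real, so it contributes exactly -Re τ · N, which the weight cancels
    -- without loss.
    have hτL : -(τ * L z).re ≤ t * ‖L 0‖ + t * ‖X‖ - τ.re * N := by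
      have e1 : (τ * L z).re = (τ * L 0).re + (τ * X).re + τ.re * N := by
        rw [hLz]
        simp
        ring
      have e2 := neg_le_of_abs_le (Complex.abs_re_le_norm (τ * L 0))
      have e3 := neg_le_of_abs_le (Complex.abs_re_le_norm (τ * X))
      rw [norm_mul] at e2 e3
      rw [e1]
      linarith
    have hb : ‖branchPow L (2 - τ) z‖ = Real.exp (2 * (L z).re) * Real.exp (-(τ * L z).re) := by
      rw [branchPow, Complex.norm_exp, ← Real.exp_add]
      congr 1
      simp
      ring
    rw [hb, Real.rpow_def_of_pos hz1, hNlog, mul_assoc, ← Real.exp_add]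
    calc Real.exp (2 * (L z).re) * Real.exp (-(τ * L z).re +
          -N * (-τ.re + C * t ^ 2 * Real.log (1 / t)))
        ≤ ((c ^ 2)⁻¹ * ‖deriv φ z‖ ^ 2) * Real.exp ((t * ‖L 0‖ + B) +
          s / (Real.log (12 / t ^ 3) + 1) * T) := by
          refine mul_le_mul (hexpL2 z hz) (Real.exp_le_exp.2 ?_) (Real.exp_pos _).le (by positivity)
          linarith
      _ = _ := by
          rw [Real.exp_add]
          ring
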